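/- Theorem (Converse Hölder and Sobolev bounds). Let $n\ge 2$ and write $x=(x_1,x')\in\mathbb R\times\mathbb R^{n-1}$, let $B_\rho^{n-1}$ be the ball of radius $\rho$ about $0$ in $\mathbb R^{n-1}$, $\tilde F=\{0\}\times B_\rho^{n-1}$, and $K_{h,\rho}=(0,h)\times B_\rho^{n-1}$. Let $\Omega\subset\mathbb R^n$ be open, bounded and convex, and suppose that for some $\rho>0$ $$\tilde F\subset\overline\Omega\subset[0,\infty)\times\mathbb R^{n-1}.$$ Let $u\in C(\overline\Omega)$ be convex, affine on $\tilde F$, with Monge–Ampère measure $\mu_u\ge\lambda\,dx$ in $\Omega$ for a constant $\lambda>0$; here $\mu_u(A)=\bigl|\bigcup_{x\in A}\partial u(x)\bigr|$ and $\partial u(x)=\{\xi: u(y)\ge u(x)+\langle\xi,y-x\rangle\ \forall y\in\Omega\}$. Call an affine bijection $L$ of $\mathbb R^n$ normalizing if $$\{0\}\times B_2^{n-1}\subset L\tilde F,\qquad L\tilde F\cup\overline{K_{2,2}}\subset L\overline\Omega\subset[0,\infty)\times\mathbb R^{n-1}.$$ Below, $Lv$ for a vector $v$, the spectral norm $|L|$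 and $\det L$ refer to the linear part of $L$. Normalizing maps exist, and one can be chosen to be a similarity ($|Lv|=|L||v|$ for all vectors $v$). Moreover: 1. There is a constant $C_n>0$ depending only on $n$ and, for every normalizing $L$, a constant $C_{L,g}$ depending only on $L$ and the boundary values $g=u|_{\partial\Omega}$, such that for every $x\in L^{-1}K_{1,1}$, with $x_0:=L^{-1}(0,(Lx)')$ and $t:=|L(x-x_0)|$, $$u(x_0)-u(x)\ \ge\ -C_{L,g}|x-x_0|+\frac{C_n\lambda^{1/n}}{|\det L|^{2/n}}\begin{cases}t\,(1/2-\ln t)^{1/2}& n=2,\\ t^{2/n}& n\ge3.\end{cases}$$ If $L$ is a similarity, then $t=|L||x-x_0|$, so the bound holds with $|L||x-x_0|$ in place of $t$. In particular, $u$ is not Lipschitz continuous on $\overline\Omega$, and not $\alpha$-Hölder continuous on $\overline\Omega$ for any $\alpha>2/n$. 2. $u$ has a weak gradient $\nabla u\in L^1_{\mathrm{loc}}(\Omega)$, and $\|\nabla u\|_{L^\infty(\Omega)}=\infty$; if $n\ge3$, also $\|\nabla u\|_{L^{n/(n-2)}(\Omega)}=\infty$. -/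

import Mathlib

open Set MeasureTheory
open scoped ENNReal NNReal ContDiff

namespace MongeAmpere

/-- `ℝⁿ` with its Euclidean norm. -/
abbrev E (n : ℕ) : Type := EuclideanSpace ℝ (Fin n)

/-- For `x = (x₁, x')`, the point `(0, x')`.  (The first coordinate has index `0`.)
Its norm is the Euclidean norm `|x'|` of `x' ∈ ℝⁿ⁻¹`. -/
noncomputable def dropFirst {n : ℕ} [NeZero n] (x : E n) : E n :=
  WithLp.toLp 2 (Function.update x.ofLp 0 0)

/-- The flat disc `{0} × B_ρⁿ⁻¹`. -/
def disc (n : ℕ) [NeZero n] (ρ : ℝ) : Set (E n) :=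
  {x | x 0 = 0 ∧ ‖dropFirst x‖ < ρ}

/-- The open cylinder `K_{h,ρ} = (0,h) × B_ρⁿ⁻¹`. -/
def cylinder (n : ℕ) [NeZero n] (h ρ : ℝ) : Set (E n) :=
  {x | 0 < x 0 ∧ x 0 < h ∧ ‖dropFirst x‖ < ρ}

/-- The closed half space `[0,∞) × ℝⁿ⁻¹`. -/
def halfSpace (n : ℕ) [NeZero n] : Set (E n) := {x | 0 ≤ x 0}

/-- The subdifferential `∂u(x)` relative to `Ω`. -/
def subdifferential {n : ℕ} (Ω : Set (E n)) (u : E n → ℝ) (x : E n) : Set (E n) :=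
  {ξ | ∀ y ∈ Ω, u x + inner ℝ ξ (y - x) ≤ u y}

/-- The Monge–Ampère measure `μ_u(A) = |⋃_{x ∈ A} ∂u(x)|`, for Borel sets `A ⊆ Ω`. -/
noncomputable def mongeAmpere {n : ℕ} (Ω : Set (E n)) (u : E n → ℝ) (A : Set (E n)) : ℝ≥0∞ :=
  volume (⋃ x ∈ A, subdifferential Ω u x)

/-- `μ_u ≥ c dx` in `Ω`. -/
def MongeAmpereGe {n : ℕ} (Ω : Set (E n)) (u : E n → ℝ) (c : ℝ) : Prop :=
  ∀ A ⊆ Ω, MeasurableSet A → ENNReal.ofReal c * volume A ≤ mongeAmpere Ω u A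

/-- `G` is a weak gradient of `u` on the open set `Ω`. -/
def IsWeakGradient {n : ℕ} (Ω : Set (E n)) (u : E n → ℝ) (G : E n → E n) : Prop :=
  LocallyIntegrableOn G Ω volume ∧
    ∀ φ : E n → ℝ, ContDiff ℝ ∞ φ → HasCompactSupport φ → tsupport φ ⊆ Ω →
      ∀ v : E n, ∫ x in Ω, u x * fderiv ℝ φ x v = -∫ x in Ω, inner ℝ (G x) v * φ x

/-- `Ω` is an open, bounded, convex set. -/
def IsConvexDomain {n : ℕ} (Ω : Set (E n)) : Prop :=
  IsOpen Ω ∧ Bornology.IsBounded Ω ∧ Convex ℝ Ω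

/-- `{0} × B_ρⁿ⁻¹ ⊆ closure Ω ⊆ [0,∞) × ℝⁿ⁻¹`, so the disc is a flat piece of the boundary. -/
def HasFlatDisc {n : ℕ} [NeZero n] (Ω : Set (E n)) (ρ : ℝ) : Prop :=
  0 < ρ ∧ disc n ρ ⊆ closure Ω ∧ closure Ω ⊆ halfSpace n

/-- `u` is convex and continuous on `closure Ω`, affine on the flat disc of radius `ρ`,
and `μ_u ≥ c dx > 0` in `Ω`. -/
structure IsAdmissible {n : ℕ} [NeZero n] (Ω : Set (E n)) (ρ c : ℝ) (u : E n → ℝ) : Prop where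
  flat : HasFlatDisc Ω ρ
  continuousOn : ContinuousOn u (closure Ω)
  convexOn : ConvexOn ℝ (closure Ω) u
  affine : ∃ l : E n →ᵃ[ℝ] ℝ, EqOn u l (disc n ρ)
  pos : 0 < c
  ge : MongeAmpereGe Ω u c

/-- The affine bijection `L` normalizes `Ω` and its flat disc of radius `ρ`:
`{0} × B₂ⁿ⁻¹ ⊆ L({0} × B_ρⁿ⁻¹)` and
`L({0} × B_ρⁿ⁻¹) ∪ closure K_{2,2} ⊆ L(closure Ω) ⊆ [0,∞) × ℝⁿ⁻¹`. -/
structure IsNormalizing {n : ℕ} [NeZero n] (Ω : Set (E n)) (ρ : ℝ) (L : E n ≃ᵃ[ℝ] E n) :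
    Prop where
  disc_subset : disc n 2 ⊆ L '' disc n ρ
  union_subset : L '' disc n ρ ∪ closure (cylinder n 2 2) ⊆ L '' closure Ω
  subset_halfSpace : L '' closure Ω ⊆ halfSpace n

/-- The linear part of `L`, as a linear map. -/
def linPart {n : ℕ} (L : E n ≃ᵃ[ℝ] E n) : E n →ₗ[ℝ] E n := (L.linear : E n →ₗ[ℝ] E n)

/-- The spectral norm `|L|` of the linear part of `L`. -/
noncomputable def specNorm {n : ℕ} (L : E n ≃ᵃ[ℝ] E n) : ℝ :=
  ‖LinearMap.toContinuousLinearMap (linPart L)‖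

/-- `|det L|`, for the linear part of `L`. -/
noncomputable def absDet {n : ℕ} (L : E n ≃ᵃ[ℝ] E n) : ℝ := |LinearMap.det (linPart L)|

/-- `L` is a similarity: `|L v| = |L| |v|` for all vectors `v`. -/
def IsSimilarity {n : ℕ} (L : E n ≃ᵃ[ℝ] E n) : Prop :=
  ∀ v : E n, ‖linPart L v‖ = specNorm L * ‖v‖

/-- The projection `x₀ = L⁻¹(0, (Lx)')`. -/
noncomputable def footPoint {n : ℕ} [NeZero n] (L : E n ≃ᵃ[ℝ] E n) (x : E n) : E n :=
  L.symm (dropFirst (L x))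

/-- `t (1/2 - ln t)^{1/2}` if `n = 2`, and `t^{2/n}` otherwise. -/
noncomputable def growth (n : ℕ) (t : ℝ) : ℝ :=
  if n = 2 then t * (1 / 2 - Real.log t) ^ (1 / 2 : ℝ) else t ^ (2 / n : ℝ)

end MongeAmpere

namespace MongeAmpere

open Filter Topology

/-! The proof is a barrier argument at the flat disc. Near a point of the disc, subtract from `u`
its affine boundary value, extended constantly in the direction transversal to the disc, and a
linear term `2 M x₁`, where `M` bounds `|u|` on the boundary. After normalization, convexity makes
the difference `v` nonpositive on `K_{2,1}`, and its Monge–Ampère measure keeps a positive lower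
bound (`MongeAmpereGe.affine_change`, `IsAdmissible.sub_foot_le`).

Compare `v` with `w = -f(x₁) (1 - |x'|²)`, which vanishes on the boundary of `K_{2,1}`. The
tangential block of its Hessian is `2 f I`, so wherever an affine function touches `w` from below,
`det D²w ≤ 2ⁿ⁻¹ fⁿ⁻¹ |f''|`. Profiles with `f(0) = 0` and `fⁿ⁻¹ |f''|` bounded can be as steep as
`t^{2/n}` for `n ≥ 3` and `t (-ln t)^{1/2}` for `n = 2` (`exists_profile`). If `w < v` on a nonempty
open set, each slope of `v` there is a gradient of `w` at a point of the same set, and the area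
formula contradicts the lower bound on the Monge–Ampère measure. Hence `v ≤ w` (`le_barrier`), and
evaluation on the axis `x' = 0` gives the pointwise bound (`IsAdmissible.foot_sub_ge`).

This growth beats `K t`, and `K t^α` for `α > 2/n`, which excludes Lipschitz and Hölder continuity.
For the gradient, the drop of `u` across a slab of width `t` at the disc bounds `∫ |∇u|` over that
slab from below by a multiple of the growth function. Hölder's inequality bounds the same integral
by a constant times `‖∇u‖_q t^{1-1/q}`. For `q = ∞` superlinear growth is the contradiction; for `q
= n/(n-2)` one has `1 - 1/q = 2/n`, the powers of `t` cancel, and the norm over the shrinking slab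
would have to stay away from zero. Any weak gradient agrees a.e. with the classical one, so these
bounds apply to it. -/

/-! ### One-dimensional profiles for the barrier. -/

/-- `f` is a concave profile on `[0, 2]`, vanishing at the end points, with first and second
derivatives `f'` and `f''` and with `f ^ (n - 1) * |f''| ≤ κ`. -/
structure IsProfile (n : ℕ) (κ : ℝ) (f f' f'' : ℝ → ℝ) : Prop where
  cont : ContinuousOn f (Icc 0 2)
  zero : f 0 = 0
  two : f 2 = 0
  pos : ∀ t ∈ Ioo (0 : ℝ) 2, 0 < f t
  deriv : ∀ t ∈ Ioo (0 : ℝ) 2, HasDerivAt f (f' t) t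
  deriv2 : ∀ t ∈ Ioo (0 : ℝ) 2, HasDerivAt f' (f'' t) t
  bound : ∀ t ∈ Ioo (0 : ℝ) 2, f t ^ (n - 1) * (-f'' t) ≤ κ
  meas : Measurable f
  meas' : Measurable f'
  meas'' : Measurable f''

/-- With `a = 2/n`, the product of `(t^a)^(n-1)` and `t^(a-2)` is `t^(na-2) = 1`, so the power `t^a`
is exactly critical. Subtracting the linear function `2^(a-1) t` makes it vanish at `2`, leaves the
second derivative alone and only lowers `f`. -/
theorem exists_profile_of_three_le (n : ℕ) (hn : 3 ≤ n) :
    ∃ c : ℝ, 0 < c ∧ ∃ f f' f'' : ℝ → ℝ, IsProfile n 1 f f' f'' ∧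
      ∀ t ∈ Ioo (0 : ℝ) 1, c * growth n t ≤ f t := by
  have hn' : (3 : ℝ) ≤ n := by exact_mod_cast hn
  obtain ⟨a, ha⟩ : ∃ a : ℝ, a = 2 / n := ⟨_, rfl⟩
  have ha0 : 0 < a := by rw [ha]; positivity
  have ha1 : a < 1 := by rw [ha, div_lt_one (by positivity)]; linarith
  have hna : (n : ℝ) * a = 2 := by rw [ha]; field_simp
  have hb : (2 : ℝ) ^ (a - 1) < 1 := Real.rpow_lt_one_of_one_lt_of_neg (by norm_num) (by linarith)
  have hb0 : (0 : ℝ) < 2 ^ (a - 1) := by positivity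
  have key : ∀ t : ℝ, 0 < t → t ^ a = t * t ^ (a - 1) := fun t ht ↦ by
    rw [Real.rpow_sub_one ht.ne']; field_simp
  refine ⟨1 - 2 ^ (a - 1), by linarith, fun t ↦ t ^ a - 2 ^ (a - 1) * t,
    fun t ↦ a * t ^ (a - 1) - 2 ^ (a - 1), fun t ↦ a * ((a - 1) * t ^ (a - 1 - 1)),
    ⟨?_, ?_, ?_, ?_, ?_, ?_, ?_, ?_, ?_, ?_⟩, ?_⟩
  · exact ((Real.continuous_rpow_const ha0.le).sub (by fun_prop)).continuousOn
  · simp [ha0.ne']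
  · simp only [key 2 two_pos]; ring
  · intro t ht
    simp only [key t ht.1]
    have : (2 : ℝ) ^ (a - 1) < t ^ (a - 1) :=
      Real.rpow_lt_rpow_of_neg ht.1 ht.2 (by linarith)
    nlinarith [mul_pos ht.1 (sub_pos.2 this)]
  · intro t ht
    have h := (Real.hasDerivAt_rpow_const (x := t) (p := a) (Or.inl ht.1.ne')).sub
      ((hasDerivAt_id t).const_mul ((2 : ℝ) ^ (a - 1)))
    exact h.congr_deriv (by simp)
  · intro t ht
    have h := ((Real.hasDerivAt_rpow_const (x := t) (p := a - 1) (Or.inl ht.1.ne')).const_mul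
      a).sub_const ((2 : ℝ) ^ (a - 1))
    simpa using h
  · intro t ht
    have h1 : 0 ≤ t ^ a - 2 ^ (a - 1) * t := by
      rw [key t ht.1]
      have : (2 : ℝ) ^ (a - 1) < t ^ (a - 1) :=
        Real.rpow_lt_rpow_of_neg ht.1 ht.2 (by linarith)
      nlinarith [mul_pos ht.1 (sub_pos.2 this)]
    have h2 : t ^ a - 2 ^ (a - 1) * t ≤ t ^ a := by nlinarith [mul_pos hb0 ht.1]
    have h3 : (0 : ℝ) < t ^ (a - 1 - 1) := Real.rpow_pos_of_pos ht.1 _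
    have h4 : -(a * ((a - 1) * t ^ (a - 1 - 1))) ≤ t ^ (a - 1 - 1) := by
      have : a * (1 - a) ≤ 1 := by nlinarith
      nlinarith
    calc _ ≤ (t ^ a) ^ (n - 1) * t ^ (a - 1 - 1) := by
          refine mul_le_mul (pow_le_pow_left₀ h1 h2 _) h4 ?_ (pow_nonneg (Real.rpow_nonneg ht.1.le _) _)
          nlinarith [mul_pos ha0 h3]
      _ = 1 := by
          rw [← Real.rpow_natCast, ← Real.rpow_mul ht.1.le, ← Real.rpow_add ht.1]
          have : a * ((n - 1 : ℕ) : ℝ) + (a - 1 - 1) = 0 := by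
            rw [Nat.cast_sub (by omega)]; push_cast; linarith
          rw [this, Real.rpow_zero]
  · fun_prop
  · fun_prop
  · fun_prop
  · intro t ht
    have h2 : n ≠ 2 := by omega
    simp only [growth, if_neg h2, ← ha]
    have : (1 : ℝ) < t ^ (a - 1) :=
      Real.one_lt_rpow_of_pos_of_lt_one_of_neg ht.1 ht.2 (by linarith)
    rw [key t ht.1]
    nlinarith [mul_pos ht.1 hb0, mul_pos (mul_pos ht.1 hb0) (sub_pos.2 this)]

/-- For `n = 2` the critical power is `t` itself, whose second derivative vanishes; the factor `√(2
- ln t)` is the logarithmic correction. The constant `2` keeps this root at least `1` on `(0, 2)`.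
-/
theorem exists_profile_two :
    ∃ c : ℝ, 0 < c ∧ ∃ f f' f'' : ℝ → ℝ, IsProfile 2 1 f f' f'' ∧
      ∀ t ∈ Ioo (0 : ℝ) 1, c * growth 2 t ≤ f t := by
  have hl2 := Real.log_two_lt_d9
  have hl2' := Real.log_two_gt_d9
  have hlog : ∀ t ∈ Ioo (0 : ℝ) 2, 1 < 2 - Real.log t := fun t ht ↦ by
    have := Real.log_lt_log ht.1 ht.2
    linarith
  refine ⟨1 / 4, by norm_num,
    fun t ↦ t * (√(2 - Real.log t) - √(2 - Real.log 2)),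
    fun t ↦ √(2 - Real.log t) - √(2 - Real.log 2) - 1 / (2 * √(2 - Real.log t)),
    fun t ↦ -(1 / (2 * t * √(2 - Real.log t))) -
      1 / (4 * t * √(2 - Real.log t) ^ 3),
    ⟨?_, ?_, ?_, ?_, ?_, ?_, ?_, ?_, ?_, ?_⟩, ?_⟩
  -- Continuity at `0`: absorbing one `√t` into the root leaves only `t ln t`, which is continuous.
  · have h : Continuous fun t : ℝ ↦ √t * √(2 * t - t * Real.log t) - t * √(2 - Real.log 2) := by
      have := Real.continuous_mul_log
      fun_prop
    refine h.continuousOn.congr fun t ht ↦ ?_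
    have : 2 * t - t * Real.log t = t * (2 - Real.log t) := by ring
    simp only [this, Real.sqrt_mul ht.1, ← mul_assoc, Real.mul_self_sqrt ht.1]
    ring
  · simp
  · simp
  · intro t ht
    have := hlog t ht
    have h2 := Real.log_lt_log ht.1 ht.2
    exact mul_pos ht.1 (sub_pos.2 (Real.sqrt_lt_sqrt (by linarith) (by linarith)))
  · intro t ht
    have h1 := hlog t ht
    have ht0 := ht.1.ne'
    have hs : 0 < √(2 - Real.log t) := Real.sqrt_pos.2 (by linarith)
    have h := (hasDerivAt_id t).mul ((((Real.hasDerivAt_log ht0).const_sub 2).sqrt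
      (by linarith)).sub_const (√(2 - Real.log 2)))
    refine h.congr_deriv ?_
    simp only [id]
    field_simp
    ring
  · intro t ht
    have h1 := hlog t ht
    have ht0 := ht.1.ne'
    have hs : 0 < √(2 - Real.log t) := Real.sqrt_pos.2 (by linarith)
    have hd := ((Real.hasDerivAt_log ht0).const_sub 2).sqrt (by linarith : (2 - Real.log t) ≠ 0)
    have h := (hd.sub_const (√(2 - Real.log 2))).sub
      (((hd.const_mul 2).inv (by positivity)))
    refine (h.congr_deriv ?_).congr_of_eventuallyEq ?_
    · field_simp
      ring
    · filter_upwards with y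
      simp
  · intro t ht
    have h1 := hlog t ht
    have ht0 := ht.1
    have h2 := Real.log_lt_log ht.1 ht.2
    have hs : 1 ≤ √(2 - Real.log t) := Real.one_le_sqrt.2 h1.le
    have hs2 : 0 ≤ √(2 - Real.log 2) := Real.sqrt_nonneg _
    have hs3 : √(2 - Real.log 2) ≤ √(2 - Real.log t) := Real.sqrt_le_sqrt (by linarith)
    generalize √(2 - Real.log t) = r at *
    generalize √(2 - Real.log 2) = q at *
    have h0 : (0 : ℝ) < r := by linarith
    have e : (t * (r - q)) ^ (2 - 1) * -(-(1 / (2 * t * r)) - 1 / (4 * t * r ^ 3)) =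
      ((r - q) / r) * (1 / 2 + 1 / (4 * r ^ 2)) := by
      norm_num
      field_simp
      ring
    rw [e]
    have e1 : (r - q) / r ≤ 1 := by rw [div_le_one h0]; linarith
    have e2 : 1 / (4 * r ^ 2) ≤ 1 / 2 := by
      rw [div_le_div_iff₀ (by positivity) (by norm_num)]
      nlinarith
    exact mul_le_one₀ e1 (by positivity) (by linarith)
  · fun_prop
  · fun_prop
  · fun_prop
  · intro t ht
    have hlt := Real.log_neg ht.1 ht.2
    simp only [growth, if_pos, ← Real.sqrt_eq_rpow]
    generalize Real.log t = r at *
    -- With `z = √(2 - r)`, `x = √(3/2)`, `y = √(1/2 - r)`, one has `z² - x² = y²` and `z + x ≤ 2z ≤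
    -- 4y`, so `z - x ≥ y/4`. Since `ln 2 > 1/2`, the number `x` dominates `√(2 - ln 2)`.
    suffices h : 1 / 4 * √(1 / 2 - r) ≤ √(2 - r) - √(2 - Real.log 2) by nlinarith [ht.1]
    have h1 : √(2 - Real.log 2) ≤ √(3 / 2) := Real.sqrt_le_sqrt (by linarith)
    have h2 : √(3 / 2) ^ 2 = 3 / 2 := Real.sq_sqrt (by norm_num)
    have h3 : √(1 / 2 - r) ^ 2 = 1 / 2 - r := Real.sq_sqrt (by linarith)
    have h4 : √(2 - r) ^ 2 = 2 - r := Real.sq_sqrt (by linarith)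
    have p2 : 0 ≤ √(3 / 2) := Real.sqrt_nonneg _
    have p3 : 0 ≤ √(1 / 2 - r) := Real.sqrt_nonneg _
    have p4 : 0 ≤ √(2 - r) := Real.sqrt_nonneg _
    generalize √(3 / 2) = x at *
    generalize √(1 / 2 - r) = y at *
    generalize √(2 - r) = z at *
    have hxz : x ≤ z := by nlinarith
    have hyz : z ≤ 2 * y := by nlinarith
    have hz : 0 < z := by nlinarith
    have : y ^ 2 = (z - x) * (z + x) := by nlinarith
    by_contra! hcon
    have : z - x < 1 / 4 * y := by linarith
    nlinarith

theorem exists_profile (n : ℕ) (hn : 2 ≤ n) :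
    ∃ c : ℝ, 0 < c ∧ ∃ f f' f'' : ℝ → ℝ, IsProfile n 1 f f' f'' ∧
      ∀ t ∈ Ioo (0 : ℝ) 1, c * growth n t ≤ f t := by
  obtain rfl | h := hn.eq_or_lt
  · exact exists_profile_two
  · exact exists_profile_of_three_le n h

theorem IsProfile.const_mul {n : ℕ} (hn : 1 ≤ n) {κ : ℝ} {f f' f'' : ℝ → ℝ}
    (h : IsProfile n κ f f' f'') {ε : ℝ} (hε : 0 < ε) :
    IsProfile n (ε ^ n * κ) (fun t ↦ ε * f t) (fun t ↦ ε * f' t) (fun t ↦ ε * f'' t) where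
  cont := continuousOn_const.mul h.cont
  zero := by simp [h.zero]
  two := by simp [h.two]
  pos t ht := mul_pos hε (h.pos t ht)
  deriv t ht := (h.deriv t ht).const_mul ε
  deriv2 t ht := (h.deriv2 t ht).const_mul ε
  bound t ht := by
    have := mul_le_mul_of_nonneg_left (h.bound t ht) (pow_pos hε n).le
    obtain ⟨m, rfl⟩ : ∃ m, n = m + 1 := ⟨n - 1, by omega⟩
    simp only [Nat.add_sub_cancel] at this ⊢
    calc _ = ε ^ (m + 1) * (f t ^ m * -f'' t) := by ring
      _ ≤ _ := this
  meas := h.meas.const_mul ε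
  meas' := h.meas'.const_mul ε
  meas'' := h.meas''.const_mul ε

/-! ### The splitting into first and remaining coordinates. -/

section Coordinates

variable {n : ℕ} [NeZero n]

/-- The first standard basis vector. -/
noncomputable def e₀ (n : ℕ) [NeZero n] : E n := EuclideanSpace.single 0 1

/-- The first coordinate, as a continuous linear functional. -/
noncomputable def coord₀ (n : ℕ) [NeZero n] : E n →L[ℝ] ℝ := EuclideanSpace.proj 0

@[simp] theorem coord₀_apply (x : E n) : coord₀ n x = x 0 := rfl

@[simp] theorem e₀_zero : e₀ n 0 = 1 := by simp [e₀]

theorem e₀_of_ne {i : Fin n} (hi : i ≠ 0) : e₀ n i = 0 := by simp [e₀, hi]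

@[simp] theorem norm_e₀ : ‖e₀ n‖ = 1 := by simp [e₀]

/-- `dropFirst` as a continuous linear map. -/
noncomputable def dropFirstL (n : ℕ) [NeZero n] : E n →L[ℝ] E n :=
  ContinuousLinearMap.id ℝ (E n) - (coord₀ n).smulRight (e₀ n)

theorem dropFirst_zero (x : E n) : dropFirst x 0 = 0 := by simp [dropFirst]

theorem dropFirst_of_ne (x : E n) {i : Fin n} (hi : i ≠ 0) : dropFirst x i = x i := by
  simp [dropFirst, hi]

theorem dropFirst_eq (x : E n) : dropFirst x = x - x 0 • e₀ n := by
  ext i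
  by_cases hi : i = 0
  · subst hi; simp [dropFirst_zero]
  · simp [dropFirst_of_ne x hi, e₀_of_ne hi]

@[simp] theorem dropFirstL_apply (x : E n) : dropFirstL n x = dropFirst x := by
  simp [dropFirstL, dropFirst_eq]

theorem dropFirst_add (x y : E n) : dropFirst (x + y) = dropFirst x + dropFirst y := by
  simp_rw [← dropFirstL_apply, map_add]

theorem dropFirst_sub (x y : E n) : dropFirst (x - y) = dropFirst x - dropFirst y := by
  simp_rw [← dropFirstL_apply, map_sub]

theorem dropFirst_smul (c : ℝ) (x : E n) : dropFirst (c • x) = c • dropFirst x := by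
  simp_rw [← dropFirstL_apply, map_smul]

@[simp] theorem dropFirst_e₀ : dropFirst (e₀ n) = 0 := by simp [dropFirst_eq]

theorem dropFirst_of_zero {x : E n} (hx : x 0 = 0) : dropFirst x = x := by
  simp [dropFirst_eq, hx]

@[simp] theorem dropFirst_dropFirst (x : E n) : dropFirst (dropFirst x) = dropFirst x :=
  dropFirst_of_zero (dropFirst_zero x)

theorem eq_dropFirst_add (x : E n) : x = dropFirst x + x 0 • e₀ n := by simp [dropFirst_eq]

theorem inner_e₀ (x : E n) : inner ℝ (e₀ n) x = x 0 := by
  simp [e₀, EuclideanSpace.inner_single_left]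

theorem inner_e₀_right (x : E n) : inner ℝ x (e₀ n) = x 0 := by
  rw [real_inner_comm, inner_e₀]

theorem inner_dropFirst (x y : E n) :
    inner ℝ (dropFirst x) (dropFirst y) = inner ℝ (dropFirst x) y := by
  rw [dropFirst_eq y, inner_sub_right, inner_smul_right, inner_e₀_right, dropFirst_zero]
  simp

theorem norm_le_add (x : E n) : ‖x‖ ≤ ‖dropFirst x‖ + |x 0| := by
  conv_lhs => rw [eq_dropFirst_add x]
  refine (norm_add_le _ _).trans ?_
  simp [norm_smul]

theorem continuous_dropFirst : Continuous (dropFirst : E n → E n) := by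
  have : (dropFirst : E n → E n) = dropFirstL n := by ext1 x; simp
  rw [this]
  exact (dropFirstL n).continuous

theorem continuous_coord₀ : Continuous fun x : E n ↦ x 0 := (coord₀ n).continuous

theorem isOpen_cylinder (h ρ : ℝ) : IsOpen (cylinder n h ρ) := by
  have h1 := continuous_coord₀ (n := n)
  have h2 := (continuous_dropFirst (n := n)).norm
  exact (isOpen_lt continuous_const h1).inter
    ((isOpen_lt h1 continuous_const).inter (isOpen_lt h2 continuous_const))

theorem closure_cylinder_subset (h ρ : ℝ) :
    closure (cylinder n h ρ) ⊆ {x | 0 ≤ x 0 ∧ x 0 ≤ h ∧ ‖dropFirst x‖ ≤ ρ} := by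
  have h1 := continuous_coord₀ (n := n)
  have h2 := (continuous_dropFirst (n := n)).norm
  refine closure_minimal (fun x hx ↦ ⟨hx.1.le, hx.2.1.le, hx.2.2.le⟩) ?_
  exact (isClosed_le continuous_const h1).inter
    ((isClosed_le h1 continuous_const).inter (isClosed_le h2 continuous_const))

theorem isBounded_cylinder (h ρ : ℝ) : Bornology.IsBounded (cylinder n h ρ) := by
  refine isBounded_iff_forall_norm_le.2 ⟨ρ + h, fun x hx ↦ (norm_le_add x).trans ?_⟩
  rw [abs_of_pos hx.1]
  exact add_le_add hx.2.2.le hx.2.1.le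

end Coordinates

/-! ### Determinants of arrow-shaped matrices. -/

section ArrowMap

variable {n : ℕ} [NeZero n]

/-- The linear map with matrix `[a, b pᵀ; b p, c I]` when `p` has vanishing first coordinate. -/
noncomputable def arrowMap (a b c : ℝ) (p : E n) : E n →L[ℝ] E n :=
  (a • coord₀ n + b • innerSL ℝ p).smulRight (e₀ n) + b • (coord₀ n).smulRight p +
    c • dropFirstL n

theorem arrowMap_apply (a b c : ℝ) (p h : E n) :
    arrowMap a b c p h =
      (a * h 0 + b * inner ℝ p h) • e₀ n + (b * h 0) • p + c • dropFirst h := by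
  simp [arrowMap, mul_smul]

/-- Block elimination: the shear along `p` removes the first column below the diagonal and leaves
the Schur complement in the corner. -/
theorem arrowMap_shear (a b c : ℝ) (hc : c ≠ 0) {p : E n} (hp : p 0 = 0) (h : E n) :
    arrowMap a b c p (h - (b / c * h 0) • p) =
      ((a - b ^ 2 * ‖p‖ ^ 2 / c) * h 0 + b * inner ℝ p h) • e₀ n + c • dropFirst h := by
  rw [arrowMap_apply, dropFirst_sub, dropFirst_smul, dropFirst_of_zero hp, inner_sub_right,
    inner_smul_right, real_inner_self_eq_norm_sq]
  have e1 : (h - (b / c * h 0) • p) 0 = h 0 := by simp [hp]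
  rw [e1, smul_sub, smul_smul]
  have e2 : c * (b / c * h 0) = b * h 0 := by field_simp
  have e3 : a * h 0 + b * (inner ℝ p h - b / c * h 0 * ‖p‖ ^ 2) =
      (a - b ^ 2 * ‖p‖ ^ 2 / c) * h 0 + b * inner ℝ p h := by field_simp; ring
  rw [e2, e3]
  abel

theorem det_arrowMap (a b c : ℝ) (hc : c ≠ 0) {p : E n} (hp : p 0 = 0) :
    (arrowMap a b c p).det = (a - b ^ 2 * ‖p‖ ^ 2 / c) * c ^ (n - 1) := by
  let B := (EuclideanSpace.basisFun (Fin n) ℝ).toBasis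
  have hB : ∀ i, B i = EuclideanSpace.single i 1 := fun i ↦ by simp [B]
  have hM : ∀ (T : E n →ₗ[ℝ] E n) i j,
      LinearMap.toMatrix B B T i j = T (EuclideanSpace.single j 1) i := fun T i j ↦ by
    rw [LinearMap.toMatrix_apply, hB]; simp [B]
  let S : E n →ₗ[ℝ] E n :=
    ((ContinuousLinearMap.id ℝ (E n) - (b / c) • (coord₀ n).smulRight p : E n →L[ℝ] E n))
  have hS : ∀ h, S h = h - (b / c * h 0) • p := fun h ↦ by simp [S, mul_smul]
  let T : E n →ₗ[ℝ] E n := (arrowMap a b c p : E n →L[ℝ] E n)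
  have hTS : ∀ h, (T ∘ₗ S) h =
      ((a - b ^ 2 * ‖p‖ ^ 2 / c) * h 0 + b * inner ℝ p h) • e₀ n + c • dropFirst h := fun h ↦ by
    rw [LinearMap.comp_apply, hS]
    exact arrowMap_shear a b c hc hp h
  -- The shear is unipotent lower triangular, and its composition with the arrow map is upper
  -- triangular with diagonal `(Schur complement, c, …, c)`.
  have hdS : LinearMap.det S = 1 := by
    rw [← LinearMap.det_toMatrix B, Matrix.det_of_isLowerTriangular]
    · refine Finset.prod_eq_one fun i _ ↦ ?_
      rw [hM, hS]
      by_cases hi : i = 0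
      · subst hi; simp [hp]
      · simp [Ne.symm hi]
    · intro i j hij
      have hij' : i < j := hij
      have hj : (0 : Fin n) ≠ j := ((Fin.zero_le i).trans_lt hij').ne
      rw [hM, hS]
      simp [hj, hij'.ne]
  have hdTS : LinearMap.det (T ∘ₗ S) = (a - b ^ 2 * ‖p‖ ^ 2 / c) * c ^ (n - 1) := by
    rw [← LinearMap.det_toMatrix B, Matrix.det_of_isUpperTriangular]
    · rw [← Finset.mul_prod_erase _ _ (Finset.mem_univ (0 : Fin n))]
      congr 1
      · rw [hM, hTS]
        simp [EuclideanSpace.inner_single_right, hp, dropFirst_zero]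
      · rw [Finset.prod_congr rfl (g := fun _ ↦ c), Finset.prod_const,
          Finset.card_erase_of_mem (Finset.mem_univ _), Finset.card_univ, Fintype.card_fin]
        intro i hi
        have hi0 := Finset.ne_of_mem_erase hi
        rw [hM, hTS]
        simp [e₀_of_ne hi0, dropFirst_of_ne _ hi0]
    · intro i j hij
      have hij' : j < i := hij
      have hi0 : i ≠ 0 := ((Fin.zero_le j).trans_lt hij').ne'
      rw [hM, hTS]
      simp [e₀_of_ne hi0, dropFirst_of_ne _ hi0, hij'.ne']
  rw [LinearMap.det_comp, hdS, mul_one] at hdTS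
  exact hdTS

end ArrowMap

/-! ### The barrier and the comparison principle. -/

/-- A negative second derivative would make `0` a local maximum too, hence `g` locally constant and
its second derivative zero. -/
theorem nonneg_of_isLocalMin_of_hasDerivAt {g g' : ℝ → ℝ} {s : ℝ} (hmin : IsLocalMin g 0)
    (h1 : ∀ᶠ r in 𝓝 0, HasDerivAt g (g' r) r) (h2 : HasDerivAt g' s 0) : 0 ≤ s := by
  by_contra! hs
  have e : deriv g =ᶠ[𝓝 0] g' := h1.mono fun r hr ↦ hr.deriv
  have hdd : deriv (deriv g) 0 = s := by rw [e.deriv_eq, h2.deriv]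
  have hmax : IsLocalMax g 0 := isLocalMax_of_deriv_deriv_neg (by rwa [hdd])
    hmin.deriv_eq_zero h1.self_of_nhds.continuousAt
  have hconst : g =ᶠ[𝓝 0] fun _ ↦ g 0 := by
    filter_upwards [hmin, hmax] with r a b using le_antisymm b a
  have hd0 : deriv g =ᶠ[𝓝 0] fun _ ↦ 0 := by
    have := hconst.deriv
    simpa using this
  have := hd0.deriv_eq
  rw [hdd] at this
  simp at this
  exact hs.ne this

section Barrier

variable {n : ℕ} [NeZero n]

/-- The barrier `-f(x₁) (1 - |x'|²)`. -/
noncomputable def barrier (f : ℝ → ℝ) (y : E n) : ℝ := -(f (y 0) * (1 - ‖dropFirst y‖ ^ 2))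

/-- The gradient of the barrier. -/
noncomputable def barrierGrad (f f' : ℝ → ℝ) (y : E n) : E n :=
  (-(f' (y 0) * (1 - ‖dropFirst y‖ ^ 2))) • e₀ n + (2 * f (y 0)) • dropFirst y

/-- The Hessian of the barrier. -/
noncomputable def barrierHess (f f' f'' : ℝ → ℝ) (y : E n) : E n →L[ℝ] E n :=
  arrowMap (-(f'' (y 0) * (1 - ‖dropFirst y‖ ^ 2))) (2 * f' (y 0)) (2 * f (y 0)) (dropFirst y)

/-- The Schur complement of the Hessian of the barrier. -/
noncomputable def barrierSchur (f f' f'' : ℝ → ℝ) (y : E n) : ℝ :=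
  -(f'' (y 0) * (1 - ‖dropFirst y‖ ^ 2)) -
    (2 * f' (y 0)) ^ 2 * ‖dropFirst y‖ ^ 2 / (2 * f (y 0))

theorem hasFDerivAt_norm_dropFirst_sq (y : E n) :
    HasFDerivAt (fun z : E n ↦ ‖dropFirst z‖ ^ 2) ((2 : ℝ) • innerSL ℝ (dropFirst y)) y := by
  have h := ((dropFirstL n).hasFDerivAt (x := y)).norm_sq
  simp only [dropFirstL_apply] at h
  refine h.congr_fderiv ?_
  ext h
  simp [inner_dropFirst]

theorem hasFDerivAt_comp_coord₀ {f : ℝ → ℝ} {d : ℝ} {y : E n} (h : HasDerivAt f d (y 0)) :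
    HasFDerivAt (fun z : E n ↦ f (z 0)) (d • coord₀ n) y :=
  h.comp_hasFDerivAt y (coord₀ n).hasFDerivAt

theorem hasFDerivAt_barrier {f f' : ℝ → ℝ} {y : E n} (h : HasDerivAt f (f' (y 0)) (y 0)) :
    HasFDerivAt (barrier f) (innerSL ℝ (barrierGrad f f' y)) y := by
  have h1 := ((hasFDerivAt_comp_coord₀ h).mul
    ((hasFDerivAt_norm_dropFirst_sq y).const_sub 1)).neg
  refine h1.congr_fderiv ?_
  ext k
  simp [barrierGrad, inner_e₀]
  ring

theorem hasFDerivAt_barrierGrad {f f' f'' : ℝ → ℝ} {y : E n} (h : HasDerivAt f (f' (y 0)) (y 0))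
    (h' : HasDerivAt f' (f'' (y 0)) (y 0)) :
    HasFDerivAt (barrierGrad f f') (barrierHess f f' f'' y) y := by
  have h1 := ((hasFDerivAt_comp_coord₀ h').mul
    ((hasFDerivAt_norm_dropFirst_sq y).const_sub 1)).neg.smul_const (e₀ n)
  have h2 := ((hasFDerivAt_comp_coord₀ h).const_mul 2).smul ((dropFirstL n).hasFDerivAt (x := y))
  have h3 := h1.add h2
  refine (h3.congr_fderiv ?_).congr_of_eventuallyEq
    (Eventually.of_forall fun z ↦ by simp [barrierGrad])
  ext1 k
  simp only [barrierHess, arrowMap_apply]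
  simp only [add_apply, ContinuousLinearMap.smulRight_apply,
    neg_apply, smul_apply, coord₀_apply, smul_eq_mul,
    innerSL_apply_apply, dropFirstL_apply]
  module

/-- The barrier need not be convex, but the second-order condition at a contact point supplies the
needed sign. One direction suffices, since the tangential block `2 f I` is already positive. -/
theorem barrierSchur_nonneg_of_isLocalMin {f f' f'' : ℝ → ℝ} {y ξ : E n} (hf : 0 < f (y 0))
    (h : ∀ᶠ t in 𝓝 (y 0), HasDerivAt f (f' t) t) (h' : HasDerivAt f' (f'' (y 0)) (y 0))
    (hmin : IsLocalMin (fun z ↦ barrier f z - inner ℝ ξ z) y) :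
    barrierGrad f f' y = ξ ∧ 0 ≤ barrierSchur f f' f'' y := by
  have hd : ∀ᶠ z in 𝓝 y, HasFDerivAt (fun z ↦ barrier f z - inner ℝ ξ z)
      (innerSL ℝ (barrierGrad f f' z - ξ)) z := by
    filter_upwards [(continuous_coord₀.tendsto y).eventually h] with z hz
    have := (hasFDerivAt_barrier hz).sub (innerSL ℝ ξ).hasFDerivAt
    rw [map_sub]
    exact this
  constructor
  · have h0 := hmin.hasFDerivAt_eq_zero hd.self_of_nhds
    have h1 := congrArg (fun T : E n →L[ℝ] ℝ ↦ T (barrierGrad f f' y - ξ)) h0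
    simp only [innerSL_apply_apply, zero_apply, inner_self_eq_zero] at h1
    exact sub_eq_zero.1 h1
  · let p := dropFirst y
    have hp : p 0 = 0 := dropFirst_zero y
    -- The sheared first basis vector: on it the Hessian form equals the Schur complement.
    let k : E n := e₀ n - ((2 * f' (y 0)) / (2 * f (y 0)) * e₀ n 0) • p
    have hc0 : Tendsto (fun r : ℝ ↦ y + r • k) (𝓝 0) (𝓝 y) := by
      have : Continuous fun r : ℝ ↦ y + r • k := by fun_prop
      simpa using this.tendsto 0
    have hline : ∀ r : ℝ, HasDerivAt (fun r : ℝ ↦ y + r • k) k r := fun r ↦ by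
      simpa using ((hasDerivAt_id r).smul_const k).const_add y
    have hmin' : IsLocalMin (fun r : ℝ ↦ barrier f (y + r • k) - inner ℝ ξ (y + r • k)) 0 := by
      have := hc0.eventually hmin
      simpa [IsLocalMin, IsMinFilter] using this
    have h1 : ∀ᶠ r in 𝓝 (0 : ℝ), HasDerivAt
        (fun r : ℝ ↦ barrier f (y + r • k) - inner ℝ ξ (y + r • k))
        (inner ℝ (barrierGrad f f' (y + r • k) - ξ) k) r := by
      filter_upwards [hc0.eventually hd] with r hr
      exact hr.comp_hasDerivAt r (hline r)
    have h2 : HasDerivAt (fun r : ℝ ↦ inner ℝ (barrierGrad f f' (y + r • k) - ξ) k)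
        (inner ℝ (barrierHess f f' f'' y k) k) 0 := by
      have hg : HasFDerivAt (barrierGrad f f') (barrierHess f f' f'' y) (y + (0 : ℝ) • k) := by
        simpa using hasFDerivAt_barrierGrad (f := f) h.self_of_nhds h'
      have := ((hg.comp_hasDerivAt (0 : ℝ) (hline 0)).sub_const ξ).inner ℝ (hasDerivAt_const 0 k)
      simpa using this
    have h3 := nonneg_of_isLocalMin_of_hasDerivAt hmin' h1 h2
    have h4 : inner ℝ (barrierHess f f' f'' y k) k = barrierSchur f f' f'' y := by
      rw [barrierHess, arrowMap_shear _ _ _ (by positivity) hp]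
      simp [inner_e₀, inner_e₀_right, hp, k, inner_smul_left, barrierSchur, p]
    rwa [h4] at h3

/-- The determinant is the Schur complement times `(2f)^(n-1)`. A nonnegative Schur complement
forces `f'' ≤ 0`, and dropping its subtracted square term and the factor `1 - |x'|² ≤ 1` bounds it
by `-f''`. -/
theorem det_barrierHess_le {κ : ℝ} {f f' f'' : ℝ → ℝ} (hP : IsProfile n κ f f' f'') {y : E n}
    (hy : y 0 ∈ Ioo (0 : ℝ) 2) (hs : 0 ≤ barrierSchur f f' f'' y) (hφ : ‖dropFirst y‖ < 1) :
    |(barrierHess f f' f'' y).det| ≤ 2 ^ (n - 1) * κ := by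
  have hf := hP.pos _ hy
  rw [barrierHess, det_arrowMap _ _ _ (by positivity) (dropFirst_zero y)]
  have hb := hP.bound _ hy
  change |barrierSchur f f' f'' y * _| ≤ _
  rw [abs_of_nonneg (by positivity), mul_pow]
  have h1 : 0 ≤ (2 * f' (y 0)) ^ 2 * ‖dropFirst y‖ ^ 2 / (2 * f (y 0)) := by positivity
  have h2 : 0 ≤ ‖dropFirst y‖ ^ 2 := by positivity
  have h3 : ‖dropFirst y‖ ^ 2 < 1 := pow_lt_one₀ (norm_nonneg _) hφ two_ne_zero
  have h4 : barrierSchur f f' f'' y ≤ -f'' (y 0) := by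
    unfold barrierSchur at hs ⊢
    have : 0 ≤ -f'' (y 0) :=
      nonneg_of_mul_nonneg_left (b := 1 - ‖dropFirst y‖ ^ 2) (by linarith) (by linarith)
    nlinarith
  calc _ = 2 ^ (n - 1) * (f (y 0) ^ (n - 1) * barrierSchur f f' f'' y) := by ring
    _ ≤ 2 ^ (n - 1) * (f (y 0) ^ (n - 1) * -f'' (y 0)) := by gcongr
    _ ≤ _ := by gcongr

theorem barrier_eq_zero_of_mem_closure {κ : ℝ} {f f' f'' : ℝ → ℝ} (hP : IsProfile n κ f f' f'')
    {y : E n} (hy : y ∈ closure (cylinder n 2 1)) (hy' : y ∉ cylinder n 2 1) :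
    barrier f y = 0 := by
  obtain ⟨h1, h2, h3⟩ := closure_cylinder_subset _ _ hy
  unfold barrier
  rcases h1.eq_or_lt with h | h
  · simp [← h, hP.zero]
  rcases h2.eq_or_lt with h' | h'
  · simp [h', hP.two]
  rcases h3.eq_or_lt with h'' | h''
  · simp [h'']
  · exact absurd ⟨h, h', h''⟩ hy'

theorem continuousOn_barrier {κ : ℝ} {f f' f'' : ℝ → ℝ} (hP : IsProfile n κ f f' f'') :
    ContinuousOn (barrier f) (closure (cylinder n 2 1)) := by
  have h1 : ContinuousOn (fun y : E n ↦ f (y 0)) (closure (cylinder n 2 1)) :=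
    hP.cont.comp continuous_coord₀.continuousOn fun y hy ↦
      ⟨(closure_cylinder_subset _ _ hy).1, (closure_cylinder_subset _ _ hy).2.1⟩
  have h2 := (continuous_dropFirst (n := n)).norm
  exact (h1.mul (continuous_const.sub (h2.pow 2)).continuousOn).neg

theorem measurable_barrierSchur {κ : ℝ} {f f' f'' : ℝ → ℝ} (hP : IsProfile n κ f f' f'') :
    Measurable (barrierSchur f f' f'' : E n → ℝ) := by
  have h1 := (continuous_coord₀ (n := n)).measurable
  have h2 := (continuous_dropFirst (n := n)).measurable.norm
  have m := hP.meas.comp h1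
  have m' := hP.meas'.comp h1
  have m'' := hP.meas''.comp h1
  simp only [Function.comp_def] at m m' m''
  exact (m''.mul (measurable_const.sub (h2.pow_const 2))).neg.sub
    ((((m'.const_mul 2).pow_const 2).mul (h2.pow_const 2)).div (m.const_mul 2))

/-- Comparison principle: a nonpositive function on the cylinder `K_{2,1}` with Monge–Ampère
measure bounded below lies below the barrier. -/
theorem le_barrier {κ c : ℝ} {f f' f'' : ℝ → ℝ} (hP : IsProfile n κ f f' f'')
    (hκ : 2 ^ (n - 1) * κ < c) (hc : 0 < c) {Ω : Set (E n)} {v : E n → ℝ}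
    (hge : MongeAmpereGe Ω v c) (hsub : cylinder n 2 1 ⊆ Ω)
    (hv : ContinuousOn v (closure (cylinder n 2 1)))
    (h0 : ∀ y ∈ closure (cylinder n 2 1), v y ≤ 0) :
    ∀ y ∈ cylinder n 2 1, v y ≤ barrier f y := by
  set D := cylinder n 2 1 with hD
  have hDo : IsOpen D := isOpen_cylinder _ _
  have hcomp : IsCompact (closure D) := (isBounded_cylinder 2 1).isCompact_closure
  have hwc := continuousOn_barrier hP
  let G : Set (E n) := {y ∈ D | barrier f y < v y}
  -- Only these points can be contact points, and only there is the Hessian determinant controlled.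
  let G' : Set (E n) := G ∩ {y | 0 ≤ barrierSchur f f' f'' y}
  have hGo : IsOpen G := by
    have := (hv.sub hwc).mono subset_closure |>.isOpen_inter_preimage hDo isOpen_Ioi (t := Ioi 0)
    convert this using 1
    ext y
    simp [G]
  have hG'm : MeasurableSet G' :=
    hGo.measurableSet.inter (measurableSet_le measurable_const (measurable_barrierSchur hP))
  have hmem : ∀ y ∈ D, y 0 ∈ Ioo (0 : ℝ) 2 := fun y hy ↦ ⟨hy.1, hy.2.1⟩
  -- Lower the plane of slope `ξ` supporting `v` at `x` until it supports the barrier, at `y` say.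
  -- There the barrier is still below `v`; since it vanishes on the boundary, where `v ≤ 0`, the
  -- point `y` is interior.
  have himg : (⋃ x ∈ G, subdifferential Ω v x) ⊆ barrierGrad f f' '' G' := by
    refine iUnion₂_subset fun x hx ξ hξ ↦ ?_
    obtain ⟨y, hy, hmin⟩ := hcomp.exists_isMinOn ⟨x, subset_closure hx.1⟩
      (hwc.sub (continuous_const.inner continuous_id : Continuous fun z ↦ inner ℝ ξ z).continuousOn)
    have hle : barrier f y - inner ℝ ξ y ≤ barrier f x - inner ℝ ξ x :=
      hmin (subset_closure hx.1)
    have hsupp : ∀ z ∈ closure D, v x - inner ℝ ξ x ≤ v z - inner ℝ ξ z := by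
      intro z hz
      refine closure_minimal (s := D)
        (t := {z ∈ closure D | v x - inner ℝ ξ x ≤ v z - inner ℝ ξ z}) ?_ ?_ hz |>.2
      · intro z hz
        refine ⟨subset_closure hz, ?_⟩
        have := hξ z (hsub hz)
        rw [inner_sub_right] at this
        linarith
      · have hcont : ContinuousOn (fun z ↦ v z - inner ℝ ξ z) (closure D) :=
          hv.sub (continuous_const.inner continuous_id).continuousOn
        exact hcont.preimage_isClosed_of_isClosed isClosed_closure
          (isClosed_Ici (a := v x - inner ℝ ξ x))
    have hlt : barrier f y < v y := by linarith [hsupp y hy, hx.2]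
    have hyD : y ∈ D := by
      by_contra hyD
      rw [barrier_eq_zero_of_mem_closure hP hy hyD] at hlt
      exact (h0 y hy).not_gt hlt
    have hloc : IsLocalMin (fun z ↦ barrier f z - inner ℝ ξ z) y :=
      hmin.isLocalMin (mem_of_superset (hDo.mem_nhds hyD) subset_closure)
    have hy0 := hmem y hyD
    obtain ⟨h1, h2⟩ := barrierSchur_nonneg_of_isLocalMin (hP.pos _ hy0)
      ((isOpen_Ioo.mem_nhds hy0 : Ioo (0 : ℝ) 2 ∈ 𝓝 (y 0)) |> fun h ↦ mem_of_superset h hP.deriv)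
      (hP.deriv2 _ hy0) hloc
    exact ⟨y, ⟨⟨hyD, hlt⟩, h2⟩, h1⟩
  have hvol : volume (barrierGrad f f' '' G') ≤ ENNReal.ofReal (2 ^ (n - 1) * κ) * volume G := by
    calc volume (barrierGrad f f' '' G')
        ≤ ∫⁻ y in G', ENNReal.ofReal |(barrierHess f f' f'' y).det| :=
          addHaar_image_le_lintegral_abs_det_fderiv volume hG'm fun y hy ↦
            (hasFDerivAt_barrierGrad (hP.deriv _ (hmem y hy.1.1))
              (hP.deriv2 _ (hmem y hy.1.1))).hasFDerivWithinAt
      _ ≤ ∫⁻ _ in G', ENNReal.ofReal (2 ^ (n - 1) * κ) :=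
          setLIntegral_mono' hG'm fun y hy ↦ ENNReal.ofReal_le_ofReal
            (det_barrierHess_le hP (hmem y hy.1.1) hy.2 hy.1.1.2.2)
      _ = ENNReal.ofReal (2 ^ (n - 1) * κ) * volume G' := setLIntegral_const _ _
      _ ≤ _ := by gcongr; exact inter_subset_left
  have hGD : G ⊆ D := fun y hy ↦ hy.1
  have hle : ENNReal.ofReal c * volume G ≤ ENNReal.ofReal (2 ^ (n - 1) * κ) * volume G :=
    (hge G (hGD.trans hsub) hGo.measurableSet).trans ((measure_mono himg).trans hvol)
  have hfin : volume G ≠ ⊤ :=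
    ((measure_mono (hGD.trans subset_closure)).trans_lt hcomp.measure_lt_top).ne
  intro y hy
  by_contra! hlt
  have hpos : volume G ≠ 0 := (hGo.measure_pos volume ⟨y, hy, hlt⟩).ne'
  rw [ENNReal.mul_le_mul_iff_left hpos hfin] at hle
  exact ((ENNReal.ofReal_lt_ofReal_iff hc).2 hκ).not_ge hle

end Barrier

/-! ### Monge–Ampère lower bounds under affine maps. -/

section AffineChange

variable {n : ℕ}

theorem apply_eq_linPart_add (L : E n ≃ᵃ[ℝ] E n) (x : E n) : L x = linPart L x + L 0 := by
  have := L.map_vadd 0 x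
  simp only [vadd_eq_add, add_zero] at this
  exact this

theorem linPart_sub (L : E n ≃ᵃ[ℝ] E n) (x y : E n) : linPart L (x - y) = L x - L y := by
  rw [map_sub, apply_eq_linPart_add L x, apply_eq_linPart_add L y]; abel

theorem det_linPart_ne_zero (L : E n ≃ᵃ[ℝ] E n) : LinearMap.det (linPart L) ≠ 0 :=
  (LinearEquiv.isUnit_det' L.linear).ne_zero

theorem absDet_pos (L : E n ≃ᵃ[ℝ] E n) : 0 < absDet L := abs_pos.2 (det_linPart_ne_zero L)

theorem norm_linPart_le (L : E n ≃ᵃ[ℝ] E n) (x : E n) : ‖linPart L x‖ ≤ specNorm L * ‖x‖ :=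
  (LinearMap.toContinuousLinearMap (linPart L)).le_opNorm x

theorem volume_preimage_affineEquiv (L : E n ≃ᵃ[ℝ] E n) (S : Set (E n)) :
    volume (L ⁻¹' S) = ENNReal.ofReal (absDet L)⁻¹ * volume S := by
  have : L ⁻¹' S = linPart L ⁻¹' ((fun x ↦ x + L 0) ⁻¹' S) := by
    ext x
    simp [← apply_eq_linPart_add]
  rw [this, Measure.addHaar_preimage_linearMap _ (det_linPart_ne_zero L),
    measure_preimage_add_right, abs_inv, absDet]

theorem det_adjoint (T : E n →ₗ[ℝ] E n) :
    LinearMap.det (LinearMap.adjoint T) = LinearMap.det T := by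
  let b := EuclideanSpace.basisFun (Fin n) ℝ
  rw [← LinearMap.det_toMatrix b.toBasis, LinearMap.toMatrix_adjoint, Matrix.det_conjTranspose,
    LinearMap.det_toMatrix]
  simp

theorem exists_inner_eq_affineMap_sub (q : E n →ᵃ[ℝ] ℝ) :
    ∃ p : E n, ∀ x y, q y - q x = inner ℝ p (y - x) := by
  refine ⟨(InnerProductSpace.toDual ℝ (E n)).symm (LinearMap.toContinuousLinearMap q.linear),
    fun x y ↦ ?_⟩
  rw [InnerProductSpace.toDual_symm_apply]
  exact (q.linearMap_vsub y x).symm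

/-- Monge–Ampère lower bounds under an affine change of variables and subtraction of an affine
function. -/
theorem MongeAmpereGe.affine_change {Ω : Set (E n)} {u : E n → ℝ} {c : ℝ}
    (h : MongeAmpereGe Ω u c) (L : E n ≃ᵃ[ℝ] E n) (q : E n →ᵃ[ℝ] ℝ) :
    MongeAmpereGe (L '' Ω) (fun y ↦ u (L.symm y) - q y) (c / absDet L ^ 2) := by
  intro S hS hSm
  have hd := absDet_pos L
  obtain ⟨p, hp⟩ := exists_inner_eq_affineMap_sub q
  have hS' : L ⁻¹' S ⊆ Ω := fun x hx ↦ by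
    obtain ⟨z, hz, hzx⟩ := hS hx
    rwa [← L.injective hzx]
  have hm : MeasurableSet (L ⁻¹' S) :=
    L.continuous_of_finiteDimensional.measurable hSm
  have key := h _ hS' hm
  let B : E n →ₗ[ℝ] E n := linPart L.symm
  have hB : |LinearMap.det (LinearMap.adjoint B)| = (absDet L)⁻¹ := by
    rw [det_adjoint]
    have : LinearMap.det B = (LinearMap.det (linPart L))⁻¹ := by
      exact (LinearEquiv.det_coe_symm L.linear)
    rw [this, abs_inv, absDet]
  -- Slopes transform by the inverse transpose, which costs one factor `|det L|⁻¹`; the volume of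
  -- `L⁻¹ S` costs the other. An inclusion suffices for a lower bound.
  have hsub : (fun ξ ↦ LinearMap.adjoint B ξ - p) '' (⋃ x ∈ L ⁻¹' S, subdifferential Ω u x) ⊆
      ⋃ y ∈ S, subdifferential (L '' Ω) (fun y ↦ u (L.symm y) - q y) y := by
    rintro _ ⟨ξ, hξ, rfl⟩
    simp only [mem_iUnion₂] at hξ ⊢
    obtain ⟨x, hx, hξ⟩ := hξ
    refine ⟨L x, hx, ?_⟩
    rintro _ ⟨z, hz, rfl⟩
    have h1 := hξ z hz
    have h2 := hp (L x) (L z)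
    have h3 : inner ℝ (LinearMap.adjoint B ξ) (L z - L x) = inner ℝ ξ (z - x) := by
      rw [LinearMap.adjoint_inner_left, linPart_sub]
      simp
    simp only [AffineEquiv.symm_apply_apply, inner_sub_left, h3]
    linarith
  have hvol : volume ((fun ξ ↦ LinearMap.adjoint B ξ - p) ''
      (⋃ x ∈ L ⁻¹' S, subdifferential Ω u x)) =
      ENNReal.ofReal (absDet L)⁻¹ * mongeAmpere Ω u (L ⁻¹' S) := by
    have : (fun ξ ↦ LinearMap.adjoint B ξ - p) = (fun ξ ↦ ξ + (-p)) ∘ LinearMap.adjoint B := by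
      ext1 ξ; simp [sub_eq_add_neg]
    rw [this, image_comp, image_add_right, measure_preimage_add_right,
      Measure.addHaar_image_linearMap, hB, mongeAmpere]
  calc ENNReal.ofReal (c / absDet L ^ 2) * volume S
      = ENNReal.ofReal (absDet L)⁻¹ * (ENNReal.ofReal c * volume (L ⁻¹' S)) := by
        rw [volume_preimage_affineEquiv, ← mul_assoc, ← mul_assoc,
          ← ENNReal.ofReal_mul (by positivity), ← ENNReal.ofReal_mul' (by positivity)]
        congr 2
        field_simp
    _ ≤ ENNReal.ofReal (absDet L)⁻¹ * mongeAmpere Ω u (L ⁻¹' S) := by gcongr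
    _ ≤ _ := hvol ▸ measure_mono hsub

end AffineChange

/-! ### Convex domains with a flat boundary disc; normalizing maps. -/

section Domain

variable {n : ℕ}

theorem IsConvexDomain.isCompact_closure {Ω : Set (E n)} (hΩ : IsConvexDomain Ω) :
    IsCompact (closure Ω) := hΩ.2.1.isCompact_closure

/-- The ray from a point of a bounded open set meets its frontier. -/
theorem exists_add_smul_mem_frontier {Ω : Set (E n)} (hΩ : IsConvexDomain Ω) {x v : E n}
    (hx : x ∈ Ω) (hv : v ≠ 0) : ∃ t : ℝ, 0 ≤ t ∧ x + t • v ∈ frontier Ω := by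
  have hc : Continuous fun t : ℝ ↦ x + t • v := by fun_prop
  have hcl : IsClosed {t : ℝ | 0 ≤ t ∧ x + t • v ∈ closure Ω} :=
    isClosed_Ici.inter (isClosed_closure.preimage hc)
  obtain ⟨R, hR⟩ := isBounded_iff_forall_norm_le.1 hΩ.isCompact_closure.isBounded
  have hv0 : 0 < ‖v‖ := norm_pos_iff.2 hv
  have hK : IsCompact {t : ℝ | 0 ≤ t ∧ x + t • v ∈ closure Ω} := by
    refine (isCompact_Icc (a := 0) (b := (R + ‖x‖) / ‖v‖)).of_isClosed_subset hcl fun t ht ↦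
      ⟨ht.1, ?_⟩
    rw [le_div_iff₀ hv0]
    calc t * ‖v‖ = ‖(x + t • v) - x‖ := by simp [norm_smul, abs_of_nonneg ht.1]
      _ ≤ ‖x + t • v‖ + ‖x‖ := norm_sub_le _ _
      _ ≤ _ := by gcongr; exact hR _ ht.2
  obtain ⟨t, ht, hmax⟩ := hK.exists_isMaxOn ⟨0, le_rfl, by simpa using subset_closure hx⟩
    continuousOn_id
  refine ⟨t, ht.1, ht.2, fun hint ↦ ?_⟩
  rw [hΩ.1.interior_eq] at hint
  have hev : ∀ᶠ s in 𝓝 t, x + s • v ∈ Ω := hc.continuousAt.eventually (hΩ.1.mem_nhds hint)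
  obtain ⟨s, hs, hts⟩ := ((hev.filter_mono nhdsWithin_le_nhds).and
    (self_mem_nhdsWithin (s := Ioi t))).exists
  have : s ≤ t := hmax (show s ∈ {t : ℝ | 0 ≤ t ∧ x + t • v ∈ closure Ω} from
    ⟨ht.1.trans (le_of_lt hts), subset_closure hs⟩)
  exact (not_lt.2 this) hts

/-- Each interior point lies on a chord parallel to `e₀ n` with both ends on the frontier; apply
convexity on it. -/
theorem le_of_le_on_frontier [NeZero n] {Ω : Set (E n)} (hΩ : IsConvexDomain Ω) {u : E n → ℝ}
    (hu : ConvexOn ℝ (closure Ω) u) {M : ℝ} (hM : ∀ x ∈ frontier Ω, u x ≤ M) {x : E n}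
    (hx : x ∈ closure Ω) : u x ≤ M := by
  by_cases hxΩ : x ∈ Ω
  · have hv : e₀ n ≠ 0 := norm_ne_zero_iff.1 (by simp)
    obtain ⟨a, ha, haf⟩ := exists_add_smul_mem_frontier hΩ hxΩ hv
    obtain ⟨b, hb, hbf⟩ := exists_add_smul_mem_frontier hΩ hxΩ (neg_ne_zero.2 hv)
    rcases ha.eq_or_lt with rfl | ha'
    · simpa using hM _ haf
    have hs : x = (b / (a + b)) • (x + a • e₀ n) + (a / (a + b)) • (x + b • -e₀ n) := by
      have h1 : b / (a + b) + a / (a + b) = 1 := by field_simp; ring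
      have h2 : b / (a + b) * a - a / (a + b) * b = 0 := by field_simp; ring
      calc x = (b / (a + b) + a / (a + b)) • x +
            (b / (a + b) * a - a / (a + b) * b) • e₀ n := by rw [h1, h2]; simp
        _ = _ := by module
    rw [hs]
    refine (hu.2 (frontier_subset_closure haf) (frontier_subset_closure hbf) (by positivity)
      (by positivity) (by field_simp; ring)).trans ?_
    simp only [smul_eq_mul]
    have h1 : b / (a + b) + a / (a + b) = 1 := by field_simp; ring
    calc _ ≤ b / (a + b) * M + a / (a + b) * M := by
          gcongr
          · exact hM _ haf
          · exact hM _ hbf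
      _ = M := by rw [← add_mul, h1, one_mul]
  · exact hM x ⟨hx, by rwa [hΩ.1.interior_eq]⟩

section Flat

variable [NeZero n]

theorem HasFlatDisc.pos_of_mem {Ω : Set (E n)} (hΩ : IsConvexDomain Ω) {ρ : ℝ}
    (h : HasFlatDisc Ω ρ) {x : E n} (hx : x ∈ Ω) : 0 < x 0 := by
  have hc : Continuous fun t : ℝ ↦ x - t • e₀ n := by fun_prop
  have hev : ∀ᶠ s in 𝓝 (0 : ℝ), x - s • e₀ n ∈ Ω :=
    hc.continuousAt.eventually (hΩ.1.mem_nhds (by simpa using hx))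
  obtain ⟨s, hs, hs0⟩ := ((hev.filter_mono nhdsWithin_le_nhds).and
    (self_mem_nhdsWithin (s := Ioi (0 : ℝ)))).exists
  have h0 := h.2.2 (subset_closure hs)
  simp only [halfSpace, mem_ofPred_eq, PiLp.sub_apply, PiLp.smul_apply, e₀_zero, smul_eq_mul,
    mul_one] at h0
  have : 0 < s := hs0
  linarith

theorem HasFlatDisc.disc_subset_frontier {Ω : Set (E n)} (hΩ : IsConvexDomain Ω) {ρ : ℝ}
    (h : HasFlatDisc Ω ρ) : disc n ρ ⊆ frontier Ω := fun x hx ↦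
  ⟨h.2.1 hx, fun hi ↦ by
    rw [hΩ.1.interior_eq] at hi
    exact (h.pos_of_mem hΩ hi).ne' hx.1⟩

theorem zero_mem_disc {ρ : ℝ} (hρ : 0 < ρ) : (0 : E n) ∈ disc n ρ := by
  refine ⟨rfl, ?_⟩
  rw [dropFirst_of_zero rfl]
  simpa using hρ

/-- A convex domain with a flat disc in its boundary contains a small cylinder over the disc. -/
theorem HasFlatDisc.exists_cylinder_subset {Ω : Set (E n)} (hΩ : IsConvexDomain Ω) {ρ : ℝ}
    (h : HasFlatDisc Ω ρ) : ∃ δ, 0 < δ ∧ δ ≤ ρ ∧ cylinder n δ δ ⊆ closure Ω := by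
  have hρ := h.1
  obtain ⟨p, hp⟩ : Ω.Nonempty := closure_nonempty_iff.1 ⟨0, h.2.1 (zero_mem_disc hρ)⟩
  have hp0 := h.pos_of_mem hΩ hp
  -- A point `x` of the small cylinder is written as `s p + (1 - s) d` with `s = x₁ / p₁ < 1/2`. The
  -- slope of the segment to `p` enters `m`, so that `d` stays in the disc: `|x' - s p'| ≤ ρ/4 < (1
  -- - s) ρ`.
  let m := 1 + ‖dropFirst p‖ / p 0
  have hm : 1 ≤ m := by simp only [m, le_add_iff_nonneg_right]; positivity
  refine ⟨min (p 0 / 2) (ρ / (4 * m)), by positivity, ?_, fun x hx ↦ ?_⟩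
  · refine (min_le_right _ _).trans ((div_le_iff₀ (by positivity)).2 ?_)
    nlinarith
  · have h1 : x 0 < p 0 / 2 := hx.2.1.trans_le (min_le_left _ _)
    have h2 : x 0 < ρ / (4 * m) := hx.2.1.trans_le (min_le_right _ _)
    have h3 : ‖dropFirst x‖ < ρ / (4 * m) := hx.2.2.trans_le (min_le_right _ _)
    have hx0 := hx.1
    obtain ⟨s, hs⟩ : ∃ s : ℝ, s = x 0 / p 0 := ⟨_, rfl⟩
    have hs0 : 0 < s := by rw [hs]; positivity
    have hs1 : s < 1 / 2 := by rw [hs, div_lt_iff₀ hp0]; linarith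
    have hsp : s * p 0 = x 0 := by rw [hs]; field_simp
    have hd : (1 - s)⁻¹ • (x - s • p) ∈ disc n ρ := by
      refine ⟨by simp [hsp], ?_⟩
      rw [dropFirst_smul, dropFirst_sub, dropFirst_smul, norm_smul, norm_inv,
        Real.norm_of_nonneg (by linarith), inv_mul_lt_iff₀ (by linarith)]
      have h4 : ‖dropFirst x - s • dropFirst p‖ ≤ ‖dropFirst x‖ + s * ‖dropFirst p‖ := by
        refine (norm_sub_le _ _).trans ?_
        rw [norm_smul, Real.norm_of_nonneg hs0.le]
      have h5 : s * ‖dropFirst p‖ = x 0 * (m - 1) := by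
        simp only [hs, m]; ring
      have h6 : ‖dropFirst x‖ + x 0 * (m - 1) ≤ ρ / (4 * m) * m := by nlinarith
      have h7 : ρ / (4 * m) * m = ρ / 4 := by field_simp
      nlinarith
    have := hΩ.2.2.closure (subset_closure hp) (h.2.1 hd) hs0.le (by linarith : 0 ≤ 1 - s)
      (by ring)
    rwa [smul_smul, mul_inv_cancel₀ (by linarith), one_smul, add_sub_cancel] at this

end Flat

/-- The dilation by a nonzero factor, as an affine equivalence. -/
noncomputable def dilation (n : ℕ) (R : ℝ) (hR : R ≠ 0) : E n ≃ᵃ[ℝ] E n :=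
  (LinearEquiv.smulOfNeZero ℝ (E n) R hR).toAffineEquiv

@[simp] theorem dilation_apply (R : ℝ) (hR : R ≠ 0) (x : E n) : dilation n R hR x = R • x := rfl

@[simp] theorem dilation_symm_apply (R : ℝ) (hR : R ≠ 0) (x : E n) :
    (dilation n R hR).symm x = R⁻¹ • x := by
  rw [AffineEquiv.symm_apply_eq, dilation_apply, smul_smul, mul_inv_cancel₀ hR, one_smul]

@[simp] theorem linPart_dilation (R : ℝ) (hR : R ≠ 0) (x : E n) :
    linPart (dilation n R hR) x = R • x := rfl

variable [NeZero n]

theorem specNorm_dilation (R : ℝ) (hR : R ≠ 0) : specNorm (dilation n R hR) = |R| := by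
  have : LinearMap.toContinuousLinearMap (linPart (dilation n R hR)) =
      R • ContinuousLinearMap.id ℝ (E n) := by
    ext1 x; simp
  rw [specNorm, this, norm_smul, ContinuousLinearMap.norm_id, mul_one, Real.norm_eq_abs]

theorem isSimilarity_dilation (R : ℝ) (hR : R ≠ 0) : IsSimilarity (dilation n R hR) := by
  intro v
  rw [specNorm_dilation, linPart_dilation, norm_smul, Real.norm_eq_abs]

theorem HasFlatDisc.exists_isNormalizing_dilation {Ω : Set (E n)} (hΩ : IsConvexDomain Ω) {ρ : ℝ}
    (h : HasFlatDisc Ω ρ) :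
    ∃ (R : ℝ) (hR : 0 < R), IsNormalizing Ω ρ (dilation n R hR.ne') := by
  obtain ⟨δ, hδ, hδρ, hsub⟩ := h.exists_cylinder_subset hΩ
  have hR : 0 < 2 / δ := by positivity
  have hmem : ∀ (s : Set (E n)) x, (2 / δ)⁻¹ • x ∈ s → x ∈ dilation n (2 / δ) hR.ne' '' s :=
    fun s x hx ↦ ⟨_, hx, by rw [dilation_apply, smul_smul, mul_inv_cancel₀ hR.ne', one_smul]⟩
  have hinv : (2 / δ)⁻¹ = δ / 2 := inv_div _ _
  refine ⟨2 / δ, hR, ⟨fun x hx ↦ hmem _ _ ⟨by simp [hx.1], ?_⟩, union_subset ?_ ?_, ?_⟩⟩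
  · rw [dropFirst_smul, norm_smul, hinv, Real.norm_of_nonneg (by positivity)]
    nlinarith [hx.2]
  · exact image_mono h.2.1
  · refine closure_minimal (fun x hx ↦ hmem _ _ (hsub ⟨?_, ?_, ?_⟩)) ?_
    · have := hx.1
      simp only [PiLp.smul_apply, smul_eq_mul]
      positivity
    · simp only [PiLp.smul_apply, smul_eq_mul, hinv]
      nlinarith [hx.2.1]
    · rw [dropFirst_smul, norm_smul, hinv, Real.norm_of_nonneg (by positivity)]
      nlinarith [hx.2.2]
    · exact (hΩ.isCompact_closure.image
        (AffineEquiv.continuous_of_finiteDimensional _)).isClosed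
  · rintro _ ⟨x, hx, rfl⟩
    have := h.2.2 hx
    simp only [halfSpace, mem_ofPred_eq, dilation_apply, PiLp.smul_apply, smul_eq_mul] at this ⊢
    positivity

end Domain

/-! ### The pointwise lower bound. -/

section Pointwise

variable {n : ℕ} [NeZero n] {Ω : Set (E n)} {ρ c : ℝ} {u : E n → ℝ} {L : E n ≃ᵃ[ℝ] E n}

theorem cylinder_mono {h h' r r' : ℝ} (hh : h ≤ h') (hr : r ≤ r') :
    cylinder n h r ⊆ cylinder n h' r' :=
  fun _ hx ↦ ⟨hx.1, hx.2.1.trans_le hh, hx.2.2.trans_le hr⟩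

/-- The preimage of the open cylinder is an open subset of `closure Ω`, and an open convex set is
the interior of its closure. -/
theorem IsNormalizing.symm_mem (hΩ : IsConvexDomain Ω) (hL : IsNormalizing Ω ρ L) {y : E n}
    (hy : y ∈ cylinder n 2 2) : L.symm y ∈ Ω := by
  have hsub : L ⁻¹' cylinder n 2 2 ⊆ closure Ω := fun x hx ↦ by
    obtain ⟨z, hz, hzx⟩ := hL.union_subset (Or.inr (subset_closure hx))
    rwa [← L.injective hzx]
  have hopen : IsOpen (L ⁻¹' cylinder n 2 2) :=
    (isOpen_cylinder 2 2).preimage L.continuous_of_finiteDimensional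
  have hmem : L.symm y ∈ L ⁻¹' cylinder n 2 2 := by simpa using hy
  have h1 : L.symm y ∈ interior (closure Ω) := mem_interior.2 ⟨_, hsub, hopen, hmem⟩
  have hne : Ω.Nonempty := closure_nonempty_iff.1 ⟨_, hsub hmem⟩
  rwa [hΩ.2.2.interior_closure_eq_interior_of_nonempty_interior
    (by rwa [hΩ.1.interior_eq]), hΩ.1.interior_eq] at h1

theorem IsNormalizing.symm_dropFirst_mem (hL : IsNormalizing Ω ρ L) {y : E n}
    (hy : ‖dropFirst y‖ < 2) : L.symm (dropFirst y) ∈ disc n ρ := by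
  obtain ⟨x, hx, hxy⟩ := hL.disc_subset ⟨dropFirst_zero y, by simpa using hy⟩
  rw [← hxy]
  simpa using hx

theorem IsAdmissible.abs_le_of_mem_disc (hΩ : IsConvexDomain Ω) (hu : IsAdmissible Ω ρ c u)
    {M : ℝ} (hM : ∀ x ∈ frontier Ω, |u x| ≤ M) {x : E n} (hx : x ∈ disc n ρ) : |u x| ≤ M :=
  hM x (hu.flat.disc_subset_frontier hΩ hx)

theorem IsAdmissible.bound_nonneg (hΩ : IsConvexDomain Ω) (hu : IsAdmissible Ω ρ c u)
    {M : ℝ} (hM : ∀ x ∈ frontier Ω, |u x| ≤ M) : 0 ≤ M :=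
  (abs_nonneg _).trans (hu.abs_le_of_mem_disc hΩ hM (zero_mem_disc hu.flat.1))

/-- Below height `1`, convexity on the segment from the foot to the point at height `1` gives the
linear bound; above it, the oscillation bound `2M` is enough. -/
theorem IsAdmissible.sub_foot_le (hΩ : IsConvexDomain Ω) (hu : IsAdmissible Ω ρ c u)
    (hL : IsNormalizing Ω ρ L) {M : ℝ} (hM : ∀ x ∈ frontier Ω, |u x| ≤ M) {y : E n}
    (hy : y ∈ cylinder n 2 2) :
    u (L.symm y) - u (L.symm (dropFirst y)) ≤ 2 * M * y 0 := by
  have hM0 := hu.bound_nonneg hΩ hM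
  have hle : ∀ x ∈ closure Ω, u x ≤ M := fun x hx ↦
    le_of_le_on_frontier hΩ hu.convexOn (fun x hx ↦ (le_abs_self _).trans (hM x hx)) hx
  have hd := hL.symm_dropFirst_mem hy.2.2
  have hlow := (abs_le.1 (hu.abs_le_of_mem_disc hΩ hM hd)).1
  have hy0 := hy.1
  rcases le_or_gt 1 (y 0) with h1 | h1
  · have := hle _ (subset_closure (hL.symm_mem hΩ hy))
    nlinarith
  · have hT : dropFirst y + e₀ n ∈ cylinder n 2 2 := by
      refine ⟨by simp [dropFirst_zero], by simp [dropFirst_zero], ?_⟩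
      simpa [dropFirst_add] using hy.2.2
    have hT' := subset_closure (hL.symm_mem hΩ hT)
    have hcomb : L.symm y =
        (1 - y 0) • L.symm (dropFirst y) + y 0 • L.symm (dropFirst y + e₀ n) := by
      have hyc : y = (1 - y 0) • dropFirst y + y 0 • (dropFirst y + e₀ n) := by
        conv_lhs => rw [eq_dropFirst_add y]
        module
      obtain ⟨k, h2⟩ : ∃ k, ∀ z, L.symm z = linPart L.symm z + k :=
        ⟨_, apply_eq_linPart_add L.symm⟩
      conv_lhs => rw [hyc]
      simp only [h2, map_add, map_smul]
      module
    have hconv := hu.convexOn.2 (hu.flat.2.1 hd) hT' (by linarith : 0 ≤ 1 - y 0) hy0.le (by ring)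
    rw [← hcomb, smul_eq_mul, smul_eq_mul] at hconv
    have := hle _ hT'
    nlinarith

/-- The barrier is centred over the foot of `x`, so that `x` lies on its axis, where it equals minus
the scaled profile. The constant in front of the linear error depends only on `M` and `L`. -/
theorem IsAdmissible.foot_sub_ge (hn : 2 ≤ n) {c₁ : ℝ} {f f' f'' : ℝ → ℝ}
    (hP : IsProfile n 1 f f' f'') (hf : ∀ t ∈ Ioo (0 : ℝ) 1, c₁ * growth n t ≤ f t)
    (hΩ : IsConvexDomain Ω) (hu : IsAdmissible Ω ρ c u) (hL : IsNormalizing Ω ρ L) {M : ℝ}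
    (hM : ∀ x ∈ frontier Ω, |u x| ≤ M) {x : E n} (hx : L x ∈ cylinder n 1 1) :
    u (footPoint L x) - u x ≥ -(2 * M * specNorm L) * ‖x - footPoint L x‖ +
      c₁ / 2 * c ^ (1 / n : ℝ) / absDet L ^ (2 / n : ℝ) *
        growth n ‖linPart L (x - footPoint L x)‖ := by
  have hM0 := hu.bound_nonneg hΩ hM
  have hd := absDet_pos L
  have hc := hu.pos
  set t := L x 0 with ht
  have ht0 : 0 < t := hx.1
  set z := dropFirst (L x) with hz
  have hz0 : z 0 = 0 := dropFirst_zero _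
  have hz1 : ‖z‖ < 1 := hx.2.2
  have hLx : L x = z + t • e₀ n := eq_dropFirst_add (L x)
  have hvec : linPart L (x - footPoint L x) = t • e₀ n := by
    rw [linPart_sub, footPoint, AffineEquiv.apply_symm_apply, ← hz, hLx]; abel
  have hnorm : ‖linPart L (x - footPoint L x)‖ = t := by
    rw [hvec, norm_smul, norm_e₀, mul_one, Real.norm_of_nonneg ht0.le]
  have htle : t ≤ specNorm L * ‖x - footPoint L x‖ := hnorm ▸ norm_linPart_le L _
  obtain ⟨l, hl⟩ := hu.affine
  let A : E n ≃ᵃ[ℝ] E n := L.trans (AffineEquiv.constVAdd ℝ (E n) (-z))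
  have hAs : ∀ y, A.symm y = L.symm (z + y) := fun y ↦ by
    rw [AffineEquiv.symm_apply_eq]
    simp [A]
  have hAdet : absDet A = absDet L := rfl
  -- The value of `u` at the foot is affine in `y` because `u` is affine on the disc; this is where
  -- flatness enters. The term `2 M y₁` makes the difference nonpositive.
  let q : E n →ᵃ[ℝ] ℝ := (l.comp ((L.symm : E n →ᵃ[ℝ] E n).comp
    (((dropFirstL n : E n →ₗ[ℝ] E n).toAffineMap).comp
      (AffineEquiv.constVAdd ℝ (E n) z : E n →ᵃ[ℝ] E n)))) +
    (2 * M) • (coord₀ n : E n →ₗ[ℝ] ℝ).toAffineMap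
  have hq : ∀ y, q y = l (L.symm (dropFirst (z + y))) + 2 * M * y 0 := fun y ↦ by simp [q]
  let v : E n → ℝ := fun y ↦ u (A.symm y) - q y
  have hge : MongeAmpereGe (A '' Ω) v (c / absDet L ^ 2) := hu.ge.affine_change A q
  have hshift : ∀ y ∈ cylinder n 2 1, z + y ∈ cylinder n 2 2 := fun y hy ↦ by
    refine ⟨by simpa [hz0] using hy.1, by simpa [hz0] using hy.2.1, ?_⟩
    rw [dropFirst_add, dropFirst_of_zero hz0]
    exact (norm_add_le _ _).trans_lt (by linarith [hy.2.2])
  have hmaps : MapsTo A.symm (cylinder n 2 1) Ω := fun y hy ↦ by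
    rw [hAs]; exact hL.symm_mem hΩ (hshift y hy)
  have hsub : cylinder n 2 1 ⊆ A '' Ω := fun y hy ↦ ⟨_, hmaps hy, by simp⟩
  have hv : ContinuousOn v (closure (cylinder n 2 1)) :=
    (hu.continuousOn.comp (AffineEquiv.continuous_of_finiteDimensional A.symm).continuousOn
      (hmaps.closure (AffineEquiv.continuous_of_finiteDimensional A.symm))).sub
      q.continuous_of_finiteDimensional.continuousOn
  have hv0 : ∀ y ∈ closure (cylinder n 2 1), v y ≤ 0 := fun y hy ↦ by
    refine le_on_closure (f := v) (g := fun _ ↦ 0) (fun y hy ↦ ?_) hv continuousOn_const hy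
    have h1 := hu.sub_foot_le hΩ hL hM (hshift y hy)
    have h2 := hl (hL.symm_dropFirst_mem (hshift y hy).2.2)
    have h3 : (z + y) 0 = y 0 := by simp [hz0]
    simp only [v, hq, hAs]
    rw [h3, h2] at h1
    linarith
  -- The final halving gives `2^(n-1) ε^n = (c / |det L|²) / 2`, the strict inequality required for
  -- comparison.
  set ε : ℝ := (c / absDet L ^ 2) ^ (1 / n : ℝ) / 2 with hε
  have hε0 : 0 < ε := by positivity
  have hεn : 2 ^ (n - 1) * (ε ^ n * 1) < c / absDet L ^ 2 := by
    have h1 : ε ^ n = (c / absDet L ^ 2) / 2 ^ n := by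
      rw [hε, div_pow, ← Real.rpow_natCast, ← Real.rpow_mul (by positivity)]
      congr 1
      rw [one_div, inv_mul_cancel₀ (by positivity), Real.rpow_one]
    have h2 : (2 : ℝ) ^ n = 2 * 2 ^ (n - 1) := by
      rw [← pow_succ']; congr 1; omega
    rw [h1, h2]
    have : 0 < c / absDet L ^ 2 := by positivity
    field_simp
    norm_num
  have hbar := le_barrier (hP.const_mul (by omega) hε0) hεn (by positivity) hge hsub hv hv0
    (t • e₀ n) ⟨by simpa using ht0, by simpa using hx.2.1.trans (by norm_num),
      by simp [dropFirst_smul]⟩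
  have hx' : A.symm (t • e₀ n) = x := by rw [hAs, ← hLx]; simp
  have hfoot : l (L.symm (dropFirst (z + t • e₀ n))) = u (footPoint L x) := by
    rw [← hLx]
    exact (hl (hL.symm_dropFirst_mem (hx.2.2.trans (by norm_num)))).symm
  simp only [v, hx', hq, hfoot, barrier, PiLp.smul_apply, e₀_zero, smul_eq_mul, mul_one,
    dropFirst_smul, dropFirst_e₀, smul_zero, norm_zero] at hbar
  have hfin := mul_le_mul_of_nonneg_left (hf t ⟨ht0, hx.2.1⟩) hε0.le
  have hεeq : c₁ / 2 * c ^ (1 / n : ℝ) / absDet L ^ (2 / n : ℝ) = ε * c₁ := by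
    rw [hε, Real.div_rpow hc.le (by positivity), ← Real.rpow_natCast (absDet L) 2,
      ← Real.rpow_mul hd.le]
    have : ((2 : ℕ) : ℝ) * (1 / n) = 2 / n := by push_cast; ring
    rw [this]
    ring
  rw [hεeq, hnorm]
  nlinarith [mul_le_mul_of_nonneg_left htle (by positivity : 0 ≤ 2 * M)]

end Pointwise

/-! ### Failure of Lipschitz and Hölder continuity. -/

/-- The alternative `α = 1` adds something only for `n = 2`, where `2/n = 1` and the logarithm still
beats linear growth. It is used to absorb linear error terms. -/
theorem eventually_mul_rpow_le_growth {n : ℕ} (hn : 2 ≤ n) {α : ℝ} (hα : 2 / (n : ℝ) < α ∨ α = 1)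
    (K : ℝ) : ∀ᶠ t in 𝓝[>] (0 : ℝ), K * t ^ α ≤ growth n t := by
  have hlt1 : ∀ᶠ t in 𝓝[>] (0 : ℝ), t < 1 :=
    nhdsWithin_le_nhds (eventually_lt_nhds one_pos)
  obtain rfl | hn3 := hn.eq_or_lt
  · have hα1 : 1 ≤ α := by
      rcases hα with h | h
      · norm_num at h; exact h.le
      · exact h.ge
    have hlog : ∀ᶠ t in 𝓝[>] (0 : ℝ), Real.log t < 1 / 2 - K ^ 2 :=
      Real.tendsto_log_nhdsGT_zero.eventually_lt_atBot _
    filter_upwards [hlt1, hlog, self_mem_nhdsWithin] with t h1 h2 h3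
    have h3 : 0 < t := h3
    have ht : t ^ α ≤ t := by
      simpa using Real.rpow_le_rpow_of_exponent_ge h3 h1.le hα1
    simp only [growth, if_pos, ← Real.sqrt_eq_rpow]
    have hK : |K| ≤ √(1 / 2 - Real.log t) := Real.abs_le_sqrt (by linarith)
    calc K * t ^ α ≤ |K| * t := by gcongr; exact le_abs_self K
      _ ≤ √(1 / 2 - Real.log t) * t := by gcongr
      _ = _ := mul_comm _ _
  · have hα' : 2 / (n : ℝ) < α := by
      rcases hα with h | rfl
      · exact h
      · have : (2 : ℝ) < n := by exact_mod_cast hn3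
        rwa [div_lt_one (by positivity)]
    have hpos : 0 < α - 2 / n := by linarith
    have hc : Tendsto (fun t : ℝ ↦ K * t ^ (α - 2 / n)) (𝓝[>] 0) (𝓝 0) := by
      have := ((Real.continuous_rpow_const hpos.le).const_mul K).tendsto 0
      simp only [Real.zero_rpow hpos.ne', mul_zero] at this
      exact this.mono_left nhdsWithin_le_nhds
    filter_upwards [hc.eventually_lt_const one_pos, self_mem_nhdsWithin] with t h1 h2
    have h2 : 0 < t := h2
    simp only [growth, if_neg hn3.ne']
    calc K * t ^ α = K * t ^ (α - 2 / n) * t ^ (2 / n : ℝ) := by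
          rw [mul_assoc, ← Real.rpow_add h2]; ring_nf
      _ ≤ 1 * t ^ (2 / n : ℝ) := by gcongr
      _ = _ := one_mul _

theorem tendsto_mul_nhdsGT_zero {R : ℝ} (hR : 0 < R) :
    Tendsto (fun s : ℝ ↦ R * s) (𝓝[>] 0) (𝓝[>] 0) := by
  refine tendsto_nhdsWithin_iff.2 ⟨?_, ?_⟩
  · have : Continuous fun s : ℝ ↦ R * s := by fun_prop
    simpa using this.tendsto 0 |>.mono_left nhdsWithin_le_nhds
  · filter_upwards [self_mem_nhdsWithin] with s (hs : 0 < s)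
    exact mul_pos hR hs

section Flat

variable {n : ℕ} [NeZero n] {Ω : Set (E n)} {ρ c : ℝ} {u : E n → ℝ}

theorem IsAdmissible.exists_frontier_bound (hΩ : IsConvexDomain Ω) (hu : IsAdmissible Ω ρ c u) :
    ∃ M, ∀ x ∈ frontier Ω, |u x| ≤ M :=
  (hΩ.isCompact_closure.of_isClosed_subset isClosed_frontier
    frontier_subset_closure).exists_bound_of_continuousOn
    (hu.continuousOn.mono frontier_subset_closure)

/-- Growth of an admissible function away from the flat disc. -/
theorem IsAdmissible.exists_growth (hn : 2 ≤ n) (hΩ : IsConvexDomain Ω)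
    (hu : IsAdmissible Ω ρ c u) :
    ∃ R > 0, ∃ ε > 0, ∃ C, ∃ δ > 0, ∀ x ∈ cylinder n δ δ,
      x ∈ Ω ∧ dropFirst x ∈ closure Ω ∧
        ε * growth n (R * x 0) - C * x 0 ≤ u (dropFirst x) - u x := by
  obtain ⟨c₁, hc₁, f, f', f'', hP, hf⟩ := exists_profile n hn
  obtain ⟨M, hM⟩ := hu.exists_frontier_bound hΩ
  obtain ⟨R, hR, hL⟩ := hu.flat.exists_isNormalizing_dilation hΩ
  have hd := absDet_pos (dilation n R hR.ne')
  have hc := hu.pos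
  refine ⟨R, hR, c₁ / 2 * c ^ (1 / n : ℝ) / absDet (dilation n R hR.ne') ^ (2 / n : ℝ),
    by positivity, 2 * M * specNorm (dilation n R hR.ne'), R⁻¹, by positivity, fun x hx ↦ ?_⟩
  have hx0 := hx.1
  have hRx : dilation n R hR.ne' x ∈ cylinder n 1 1 := by
    refine ⟨by simpa using by positivity, ?_, ?_⟩
    · have := (lt_inv_mul_iff₀ hR (b := 1)).1 (by simpa using hx.2.1)
      simpa using this
    · have := (lt_inv_mul_iff₀ hR (b := 1)).1 (by simpa using hx.2.2)
      simpa [dropFirst_smul, norm_smul, abs_of_pos hR] using this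
  have hfoot : footPoint (dilation n R hR.ne') x = dropFirst x := by
    simp only [footPoint, dilation_apply, dilation_symm_apply, dropFirst_smul]
    rw [smul_smul, inv_mul_cancel₀ hR.ne', one_smul]
  have hsub : x - dropFirst x = x 0 • e₀ n := by rw [dropFirst_eq]; abel
  have hn1 : ‖x - dropFirst x‖ = x 0 := by
    rw [hsub, norm_smul, norm_e₀, mul_one, Real.norm_of_nonneg hx0.le]
  have hn2 : ‖linPart (dilation n R hR.ne') (x - dropFirst x)‖ = R * x 0 := by
    rw [linPart_dilation, norm_smul, hn1, Real.norm_of_nonneg hR.le]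
  refine ⟨?_, ?_, ?_⟩
  · have := hL.symm_mem hΩ (cylinder_mono one_le_two one_le_two hRx)
    rwa [AffineEquiv.symm_apply_apply] at this
  · rw [← hfoot]
    exact hu.flat.2.1 (hL.symm_dropFirst_mem (hRx.2.2.trans one_lt_two))
  · have := hu.foot_sub_ge hn hP hf hΩ hL hM hRx
    rw [hfoot, hn1, hn2] at this
    linarith

theorem IsAdmissible.not_holderOnWith (hn : 2 ≤ n) (hΩ : IsConvexDomain Ω)
    (hu : IsAdmissible Ω ρ c u) {α : ℝ≥0} (hα : 2 / (n : ℝ) < α ∨ (α : ℝ) = 1) (K : ℝ≥0) :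
    ¬ HolderOnWith K α u (closure Ω) := by
  intro hH
  obtain ⟨R, hR, ε, hε, C, δ, hδ, h⟩ := hu.exists_growth hn hΩ
  have hs := tendsto_mul_nhdsGT_zero hR
  -- Half of the growth absorbs `C s` with a surplus `R s`, which makes the contradiction strict;
  -- the other half absorbs the Hölder bound.
  have e1 := hs.eventually (eventually_mul_rpow_le_growth hn (Or.inr rfl)
    (2 / ε * (|C| / R + 1)))
  have e2 := hs.eventually (eventually_mul_rpow_le_growth hn hα (2 / ε * (K / R ^ (α : ℝ))))
  have e3 : ∀ᶠ s in 𝓝[>] (0 : ℝ), s < δ := nhdsWithin_le_nhds (eventually_lt_nhds hδ)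
  obtain ⟨s, h1, h2, h3, h4⟩ := (e1.and (e2.and (e3.and self_mem_nhdsWithin))).exists
  have h4 : 0 < s := h4
  obtain ⟨g1, g2, g3⟩ := h (s • e₀ n) ⟨by simpa using h4, by simpa using h3,
    by simpa [dropFirst_smul] using hδ⟩
  have hd := hH.dist_le g2 (subset_closure g1)
  simp only [dropFirst_smul, dropFirst_e₀, smul_zero, dist_zero_left, norm_smul, norm_e₀, mul_one,
    Real.norm_of_nonneg h4.le, PiLp.smul_apply, e₀_zero, smul_eq_mul] at hd g3
  have hd' := (le_abs_self _).trans hd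
  rw [Real.rpow_one] at h1
  rw [Real.mul_rpow hR.le h4.le] at h2
  have i1 : (|C| + R) * s ≤ ε / 2 * growth n (R * s) := by
    have := mul_le_mul_of_nonneg_left h1 (by positivity : 0 ≤ ε / 2)
    have e : ε / 2 * (2 / ε * (|C| / R + 1) * (R * s)) = (|C| + R) * s := by field_simp
    rwa [e] at this
  have i2 : K * s ^ (α : ℝ) ≤ ε / 2 * growth n (R * s) := by
    have := mul_le_mul_of_nonneg_left h2 (by positivity : 0 ≤ ε / 2)
    have hRα : 0 < R ^ (α : ℝ) := by positivity
    have e : ε / 2 * (2 / ε * (K / R ^ (α : ℝ)) * (R ^ (α : ℝ) * s ^ (α : ℝ))) =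
        K * s ^ (α : ℝ) := by field_simp
    rwa [e] at this
  have i3 : C * s ≤ |C| * s := by gcongr; exact le_abs_self C
  nlinarith [mul_pos hR h4]

theorem IsAdmissible.not_lipschitzOnWith (hn : 2 ≤ n) (hΩ : IsConvexDomain Ω)
    (hu : IsAdmissible Ω ρ c u) (K : ℝ≥0) : ¬ LipschitzOnWith K u (closure Ω) := fun h ↦
  hu.not_holderOnWith hn hΩ (α := 1) (Or.inr (by simp)) K (holderOnWith_one.2 h)

end Flat

/-! ### The classical gradient of a convex function is its weak gradient. -/

section WeakGradient

variable {n : ℕ} {Ω : Set (E n)} {u : E n → ℝ}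

theorem inner_gradient (u : E n → ℝ) (x v : E n) :
    inner ℝ (gradient u x) v = fderiv ℝ u x v := by
  rw [gradient, InnerProductSpace.toDual_symm_apply]

theorem measurable_gradient (u : E n → ℝ) : Measurable (gradient u) :=
  (InnerProductSpace.toDual ℝ (E n)).symm.continuous.measurable.comp (measurable_fderiv ℝ u)

theorem norm_gradient (u : E n → ℝ) (x : E n) : ‖gradient u x‖ = ‖fderiv ℝ u x‖ := by
  rw [gradient, LinearIsometryEquiv.norm_map]

theorem exists_lipschitzWith_eqOn (hΩ : IsOpen Ω) (hu : ConvexOn ℝ Ω u) {K : Set (E n)}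
    (hK : IsCompact K) (hKΩ : K ⊆ Ω) : ∃ C : ℝ≥0, ∃ w, LipschitzWith C w ∧ EqOn u w K := by
  obtain ⟨C, hC⟩ := ((hu.locallyLipschitzOn hΩ).mono hKΩ).exists_lipschitzOnWith_of_compact hK
  obtain ⟨w, hw, huw⟩ := hC.extend_real
  exact ⟨C, w, hw, huw⟩

/-- Rademacher's theorem for Lipschitz extensions from small balls, patched together by local
nullity. -/
theorem ae_differentiableAt_of_convexOn (hΩ : IsOpen Ω) (hu : ConvexOn ℝ Ω u) :
    ∀ᵐ x, x ∈ Ω → DifferentiableAt ℝ u x := by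
  have key : ∀ x ∈ Ω, ∃ t ∈ 𝓝[Ω] x, volume (t ∩ {y | ¬ (y ∈ Ω → DifferentiableAt ℝ u y)}) = 0 := by
    intro x hx
    obtain ⟨r, hr, hrΩ⟩ := Metric.nhds_basis_closedBall.mem_iff.1 (hΩ.mem_nhds hx)
    obtain ⟨C, w, hw, huw⟩ := exists_lipschitzWith_eqOn hΩ hu (isCompact_closedBall x r) hrΩ
    refine ⟨Metric.ball x r, nhdsWithin_le_nhds (Metric.ball_mem_nhds x hr), ?_⟩
    refine measure_mono_null ?_ (ae_iff.1 hw.ae_differentiableAt)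
    rintro y ⟨hy, hyd⟩ hd
    refine hyd fun _ ↦ hd.congr_of_eventuallyEq ?_
    filter_upwards [Metric.isOpen_ball.mem_nhds hy] with z hz
    exact huw (Metric.ball_subset_closedBall hz)
  have h0 := measure_null_of_locally_null {y | ¬ (y ∈ Ω → DifferentiableAt ℝ u y)} (μ := volume)
    fun x hx ↦ by
      have hxΩ : x ∈ Ω := by
        by_contra h
        exact hx fun h' ↦ absurd h' h
      obtain ⟨t, ht, h⟩ := key x hxΩ
      rw [hΩ.nhdsWithin_eq hxΩ] at ht
      exact ⟨_, inter_mem (nhdsWithin_le_nhds ht) self_mem_nhdsWithin, h⟩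
  exact ae_iff.2 h0

theorem locallyIntegrableOn_gradient (hΩ : IsOpen Ω) (hu : ConvexOn ℝ Ω u) :
    LocallyIntegrableOn (gradient u) Ω := by
  intro x hx
  obtain ⟨r, hr, hrΩ⟩ := Metric.nhds_basis_closedBall.mem_iff.1 (hΩ.mem_nhds hx)
  obtain ⟨C, hC⟩ := ((hu.locallyLipschitzOn hΩ).mono hrΩ).exists_lipschitzOnWith_of_compact
    (isCompact_closedBall x r)
  refine ⟨Metric.ball x r, nhdsWithin_le_nhds (Metric.ball_mem_nhds x hr), ?_⟩
  refine Measure.integrableOn_of_bounded (M := C) measure_ball_lt_top.ne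
    (measurable_gradient u).aestronglyMeasurable ?_
  refine (ae_restrict_iff' measurableSet_ball).2 (Eventually.of_forall fun y hy ↦ ?_)
  rw [norm_gradient]
  exact norm_fderiv_le_of_lipschitzOn ℝ
    (mem_of_superset (Metric.isOpen_ball.mem_nhds hy) Metric.ball_subset_closedBall) hC

theorem isWeakGradient_gradient (hΩ : IsOpen Ω) (hu : ConvexOn ℝ Ω u) :
    IsWeakGradient Ω u (gradient u) := by
  refine ⟨locallyIntegrableOn_gradient hΩ hu, fun φ hφ hφc hφΩ v ↦ ?_⟩
  have hKc : IsCompact (tsupport φ) := hφc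
  -- The extension must agree with `u` on a neighbourhood of the support of `φ`, so that the
  -- derivatives agree there too. Integration by parts is then available for globally Lipschitz
  -- functions.
  obtain ⟨δ, hδ, hδΩ⟩ := hKc.exists_cthickening_subset_open hΩ hφΩ
  obtain ⟨C, w, hw, huw⟩ := exists_lipschitzWith_eqOn hΩ hu hKc.cthickening hδΩ
  obtain ⟨D, hD⟩ := hφ.lipschitzWith_of_hasCompactSupport hφc (by simp)
  have hev : ∀ x ∈ tsupport φ, u =ᶠ[𝓝 x] w := fun x hx ↦ by
    filter_upwards [Metric.isOpen_thickening.mem_nhds (Metric.self_subset_thickening hδ _ hx)]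
      with z hz
    exact huw (Metric.thickening_subset_cthickening _ _ hz)
  have h1 : ∫ x in Ω, u x * fderiv ℝ φ x v = ∫ x, w x * fderiv ℝ φ x v := by
    rw [setIntegral_eq_integral_of_forall_compl_eq_zero]
    · refine integral_congr_ae (Eventually.of_forall fun x ↦ ?_)
      by_cases hx : x ∈ tsupport φ
      · simp only [(hev x hx).self_of_nhds]
      · simp [fderiv_of_notMem_tsupport (𝕜 := ℝ) hx]
    · intro x hx
      simp [fderiv_of_notMem_tsupport (𝕜 := ℝ) (fun h ↦ hx (hφΩ h))]
  have h2 : ∫ x in Ω, inner ℝ (gradient u x) v * φ x = ∫ x, lineDeriv ℝ w x v * φ x := by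
    rw [setIntegral_eq_integral_of_forall_compl_eq_zero]
    · refine integral_congr_ae ?_
      filter_upwards [hw.ae_differentiableAt] with x hd
      by_cases hx : x ∈ tsupport φ
      · rw [inner_gradient, (hev x hx).fderiv_eq, hd.lineDeriv_eq_fderiv]
      · simp [image_eq_zero_of_notMem_tsupport hx]
    · intro x hx
      simp [image_eq_zero_of_notMem_tsupport (fun h ↦ hx (hφΩ h))]
  rw [h1, h2, hw.integral_lineDeriv_mul_eq hD hφc, ← integral_neg]
  refine integral_congr_ae (Eventually.of_forall fun x ↦ ?_)
  have : DifferentiableAt ℝ φ x := hφ.differentiable (by simp) x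
  simp only [this.lineDeriv_eq_fderiv, map_neg]
  ring

theorem integrable_mul_of_tsupport_subset {F φ : E n → ℝ} (hF : LocallyIntegrableOn F Ω)
    (hφ : Continuous φ) (hφc : HasCompactSupport φ) (hφΩ : tsupport φ ⊆ Ω) :
    Integrable fun x ↦ F x * φ x := by
  have h1 := (hF.integrableOn_compact_subset hφΩ hφc).mul_continuousOn hφ.continuousOn hφc
  exact h1.integrable_of_forall_notMem_eq_zero fun x hx ↦ by
    simp [image_eq_zero_of_notMem_tsupport hx]

theorem IsWeakGradient.ae_eq {G G' : E n → E n} (hΩ : IsOpen Ω) (hG : IsWeakGradient Ω u G)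
    (hG' : IsWeakGradient Ω u G') : G =ᵐ[volume.restrict Ω] G' := by
  have hin : ∀ {G : E n → E n}, LocallyIntegrableOn G Ω → ∀ v : E n,
      LocallyIntegrableOn (fun x ↦ inner ℝ (G x) v) Ω := fun hG v x hx ↦ by
    obtain ⟨s, hs, h⟩ := hG x hx
    exact ⟨s, hs, h.inner_const v⟩
  have key : ∀ i : Fin n, ∀ᵐ x, x ∈ Ω →
      inner ℝ (G x) (EuclideanSpace.single i 1) - inner ℝ (G' x) (EuclideanSpace.single i 1) =
        (0 : ℝ) := by
    intro i
    refine hΩ.ae_eq_zero_of_integral_contDiff_smul_eq_zero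
      ((hin hG.1 _).sub (hin hG'.1 _)) fun φ hφ hφc hφΩ ↦ ?_
    have i1 := integrable_mul_of_tsupport_subset (hin hG.1 (EuclideanSpace.single i 1))
      hφ.continuous hφc hφΩ
    have i2 := integrable_mul_of_tsupport_subset (hin hG'.1 (EuclideanSpace.single i 1))
      hφ.continuous hφc hφΩ
    have e1 := hG.2 φ hφ hφc hφΩ (EuclideanSpace.single i 1)
    have e2 := hG'.2 φ hφ hφc hφΩ (EuclideanSpace.single i 1)
    have hz : ∀ {F : E n → ℝ}, ∫ x in Ω, F x * φ x = ∫ x, F x * φ x := fun {F} ↦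
      setIntegral_eq_integral_of_forall_compl_eq_zero fun x hx ↦ by
        simp [image_eq_zero_of_notMem_tsupport (fun h ↦ hx (hφΩ h))]
    rw [hz] at e1 e2
    calc _ = ∫ x, (inner ℝ (G x) (EuclideanSpace.single i 1) * φ x -
          inner ℝ (G' x) (EuclideanSpace.single i 1) * φ x) := by
          refine integral_congr_ae (Eventually.of_forall fun x ↦ ?_)
          simp only [smul_eq_mul]; ring
      _ = 0 := by rw [integral_sub i1 i2]; linarith
  refine (ae_restrict_iff' hΩ.measurableSet).2 ?_
  filter_upwards [ae_all_iff.2 key] with x hx hxΩ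
  ext i
  have := hx i hxΩ
  simp only [EuclideanSpace.inner_single_right] at this
  simpa [sub_eq_zero] using this

/-- A convex function lies above its tangent planes. -/
theorem add_fderiv_le_of_convexOn {s : Set (E n)} (hu : ConvexOn ℝ s u) {x y : E n} (hx : x ∈ s)
    (hy : y ∈ s) (hd : DifferentiableAt ℝ u x) : u x + fderiv ℝ u x (y - x) ≤ u y := by
  have h1 : HasLineDerivAt ℝ u (fderiv ℝ u x (y - x)) x (y - x) :=
    hd.hasFDerivAt.hasLineDerivAt _
  have h2 := h1.tendsto_slope_zero_right
  suffices fderiv ℝ u x (y - x) ≤ u y - u x by linarith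
  refine le_of_tendsto h2 ?_
  filter_upwards [self_mem_nhdsWithin,
    nhdsWithin_le_nhds (eventually_lt_nhds (one_pos : (0 : ℝ) < 1))] with t (h0 : 0 < t) ht1
  have h3 := hu.2 hx hy (by linarith : 0 ≤ 1 - t) h0.le (by ring)
  have h4 : (1 - t) • x + t • y = x + t • (y - x) := by module
  rw [h4, smul_eq_mul, smul_eq_mul] at h3
  rw [smul_eq_mul, inv_mul_le_iff₀ h0]
  linarith

end WeakGradient

/-! ### Blow-up of the gradient norms. -/

section Blowup

variable {n : ℕ} [NeZero n]

/-- The box of points with `a < x₁ < b` and `|xᵢ| < r` for the other coordinates. -/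
def slab (n : ℕ) [NeZero n] (a b r : ℝ) : Set (E n) :=
  {x | x 0 ∈ Ioo a b ∧ ∀ i ≠ 0, x i ∈ Ioo (-r) r}

theorem measurableSet_slab (a b r : ℝ) : MeasurableSet (slab n a b r) := by
  have h : ∀ i, Measurable fun x : E n ↦ x i := fun i ↦
    (EuclideanSpace.proj i : E n →L[ℝ] ℝ).continuous.measurable
  have h2 : slab n a b r = (fun x ↦ x 0) ⁻¹' Ioo a b ∩
      ⋂ (i : Fin n) (_ : i ≠ 0), (fun x ↦ x i) ⁻¹' Ioo (-r) r := by
    ext x; simp [slab]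
  rw [h2]
  exact (h 0 measurableSet_Ioo).inter
    (MeasurableSet.iInter fun i ↦ MeasurableSet.iInter fun _ ↦ h i measurableSet_Ioo)

theorem volume_slab (a b r : ℝ) :
    volume (slab n a b r) = ENNReal.ofReal (b - a) * ENNReal.ofReal (2 * r) ^ (n - 1) := by
  have h : slab n a b r = WithLp.ofLp ⁻¹'
      univ.pi fun i : Fin n ↦ Ioo (if i = 0 then a else -r) (if i = 0 then b else r) := by
    ext x
    simp only [slab, mem_ofPred_eq, mem_preimage, mem_univ_pi]
    constructor
    · rintro ⟨h0, h1⟩ i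
      by_cases hi : i = 0
      · subst hi; simpa using h0
      · simpa [hi] using h1 i hi
    · intro h
      exact ⟨by simpa using h 0, fun i hi ↦ by simpa [hi] using h i⟩
  rw [h, (PiLp.volume_preserving_ofLp (Fin n)).measure_preimage
    (MeasurableSet.univ_pi fun _ ↦ measurableSet_Ioo).nullMeasurableSet, Real.volume_pi_Ioo,
    ← Finset.mul_prod_erase _ _ (Finset.mem_univ (0 : Fin n)),
    Finset.prod_congr rfl (g := fun _ ↦ ENNReal.ofReal (2 * r)), Finset.prod_const,
    Finset.card_erase_of_mem (Finset.mem_univ _), Finset.card_univ, Fintype.card_fin]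
  · simp
  · intro i hi
    simp only [Finset.ne_of_mem_erase hi, if_false]
    congr 1; ring

theorem norm_dropFirst_lt_of_mem_slab (hn : 2 ≤ n) {a b δ : ℝ} (hδ : 0 < δ) {x : E n}
    (hx : x ∈ slab n a b (δ / n)) : ‖dropFirst x‖ < δ := by
  have hn' : (2 : ℝ) ≤ n := by exact_mod_cast hn
  have h : ‖dropFirst x‖ ^ 2 ≤ n * (δ / n) ^ 2 := by
    rw [EuclideanSpace.norm_sq_eq]
    calc _ ≤ ∑ _i : Fin n, (δ / n) ^ 2 := by
          refine Finset.sum_le_sum fun i _ ↦ ?_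
          refine pow_le_pow_left₀ (norm_nonneg _) ?_ 2
          by_cases hi : i = 0
          · subst hi
            rw [dropFirst_zero, norm_zero]
            positivity
          · rw [dropFirst_of_ne _ hi, Real.norm_eq_abs]
            exact (abs_lt.2 (hx.2 i hi)).le
      _ = _ := by simp
  have h2 : n * (δ / n) ^ 2 < δ ^ 2 := by
    have : n * (δ / n) ^ 2 = δ ^ 2 / n := by field_simp
    rw [this, div_lt_iff₀ (by positivity)]
    nlinarith [pow_pos hδ 2]
  exact lt_of_pow_lt_pow_left₀ 2 hδ.le (h.trans_lt h2)

theorem slab_subset_cylinder (hn : 2 ≤ n) {a b δ : ℝ} (hδ : 0 < δ) (ha : 0 ≤ a) (hb : b ≤ δ) :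
    slab n a b (δ / n) ⊆ cylinder n δ δ := fun _ hx ↦
  ⟨ha.trans_lt hx.1.1, hx.1.2.trans_le hb, norm_dropFirst_lt_of_mem_slab hn hδ hx⟩

theorem mem_slab_add_iff {a b r s : ℝ} {x : E n} :
    x + s • e₀ n ∈ slab n a b r ↔ x ∈ slab n (a - s) (b - s) r := by
  simp only [slab, mem_ofPred_eq, PiLp.add_apply, PiLp.smul_apply, e₀_zero, smul_eq_mul, mul_one]
  refine and_congr ?_ (forall₂_congr fun i hi ↦ by simp [e₀_of_ne hi])
  simp only [mem_Ioo]
  constructor <;> rintro ⟨h1, h2⟩ <;> constructor <;> linarith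

theorem setLIntegral_slab_add (F : E n → ℝ≥0∞) (a b r s : ℝ) :
    ∫⁻ x in slab n a b r, F (x + s • e₀ n) = ∫⁻ x in slab n (a + s) (b + s) r, F x := by
  rw [← lintegral_indicator (measurableSet_slab _ _ _),
    ← lintegral_indicator (measurableSet_slab _ _ _),
    ← lintegral_add_right_eq_self ((slab n (a + s) (b + s) r).indicator F) (s • e₀ n)]
  congr 1
  ext1 x
  have h : x + s • e₀ n ∈ slab n (a + s) (b + s) r ↔ x ∈ slab n a b r := by
    rw [mem_slab_add_iff]; simp
  by_cases hx : x ∈ slab n a b r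
  · rw [indicator_of_mem hx, indicator_of_mem (h.2 hx)]
  · rw [indicator_of_notMem hx, indicator_of_notMem (fun h' ↦ hx (h.1 h'))]

theorem sum_setLIntegral_slab_le (F : E n → ℝ≥0∞) {a : ℝ} (ha : 0 ≤ a) (r : ℝ) (N : ℕ) :
    ∑ k ∈ Finset.range N, ∫⁻ x in slab n (k * a) ((k + 1) * a) r, F x ≤
      ∫⁻ x in slab n 0 (N * a) r, F x := by
  rw [← lintegral_biUnion_finset]
  · refine lintegral_mono_set (iUnion₂_subset fun k hk x hx ↦ ⟨⟨?_, ?_⟩, hx.2⟩)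
    · exact lt_of_le_of_lt (by positivity) hx.1.1
    · refine hx.1.2.trans_le ?_
      have : ((k : ℝ) + 1) ≤ N := by exact_mod_cast Finset.mem_range.1 hk
      gcongr
  · intro i _ j _ hij
    refine Set.disjoint_left.2 fun x hx hx' ↦ ?_
    rcases lt_or_gt_of_ne hij with h | h
    · have h' : ((i : ℝ) + 1) ≤ j := by exact_mod_cast h
      have := mul_le_mul_of_nonneg_right h' ha
      exact absurd hx.1.2 (not_lt.2 (this.trans hx'.1.1.le))
    · have h' : ((j : ℝ) + 1) ≤ i := by exact_mod_cast h
      have := mul_le_mul_of_nonneg_right h' ha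
      exact absurd hx'.1.2 (not_lt.2 (this.trans hx.1.1.le))
  · exact fun k _ ↦ measurableSet_slab _ _ _

/-- Telescoping with tangent planes at the left end points: a one-sided Riemann sum replaces the
fundamental theorem of calculus along the line. -/
theorem sub_le_sum_norm_gradient {Ω : Set (E n)} {u : E n → ℝ} (hu : ConvexOn ℝ Ω u) {x : E n}
    {a : ℝ} (ha : 0 ≤ a) (N : ℕ) (hx : ∀ k ≤ N, x + (k * a) • e₀ n ∈ Ω)
    (hd : ∀ k < N, DifferentiableAt ℝ u (x + (k * a) • e₀ n)) :
    u x - u (x + (N * a) • e₀ n) ≤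
      a * ∑ k ∈ Finset.range N, ‖gradient u (x + (k * a) • e₀ n)‖ := by
  have h0 : u x = u (x + ((0 : ℕ) * a) • e₀ n) := by simp
  rw [h0, ← Finset.sum_range_sub' (fun k : ℕ ↦ u (x + (k * a) • e₀ n)) N, Finset.mul_sum]
  refine Finset.sum_le_sum fun k hk ↦ ?_
  have hk' := Finset.mem_range.1 hk
  have h1 := add_fderiv_le_of_convexOn hu (hx k hk'.le) (hx (k + 1) hk') (hd k hk')
  have h2 : x + ((k + 1 : ℕ) * a) • e₀ n - (x + (k * a) • e₀ n) = a • e₀ n := by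
    push_cast; module
  rw [h2, ← inner_gradient] at h1
  have h3 := abs_le.1 (abs_real_inner_le_norm (gradient u (x + (k * a) • e₀ n)) (a • e₀ n)) |>.1
  rw [norm_smul, norm_e₀, mul_one, Real.norm_of_nonneg ha] at h3
  linarith

/-- A drop of size `m` of a convex function across a thin slab bounds the integral of its gradient
from below. -/
theorem ofReal_mul_le_lintegral_gradient {Ω : Set (E n)} {u : E n → ℝ} (hΩ : IsOpen Ω)
    (hu : ConvexOn ℝ Ω u) {a r m : ℝ} (ha : 0 < a) (N : ℕ)
    (hm : ∀ x ∈ slab n 0 a r, (∀ k ≤ N, x + ((k : ℕ) * a) • e₀ n ∈ Ω) ∧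
      m ≤ u x - u (x + (N * a) • e₀ n)) :
    ENNReal.ofReal m * ENNReal.ofReal (2 * r) ^ (n - 1) ≤
      ∫⁻ x in slab n 0 (N * a) r, ‖gradient u x‖ₑ := by
  have hdiff : ∀ᵐ x : E n, ∀ k : ℕ, x + (k * a) • e₀ n ∈ Ω →
      DifferentiableAt ℝ u (x + (k * a) • e₀ n) := ae_all_iff.2 fun k ↦
    (measurePreserving_add_right volume ((k * a) • e₀ n)).quasiMeasurePreserving.ae
      (ae_differentiableAt_of_convexOn hΩ hu)
  have hmeas : Measurable fun x ↦ ‖gradient u x‖ₑ := (measurable_gradient u).enorm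
  -- Integrating over starting points in a slab of width `a` turns the sum into integrals over
  -- disjoint translates. The factor `a` then appears on both sides and cancels.
  have key : ENNReal.ofReal m * volume (slab n 0 a r) ≤
      ENNReal.ofReal a * ∫⁻ x in slab n 0 (N * a) r, ‖gradient u x‖ₑ := by
    calc ENNReal.ofReal m * volume (slab n 0 a r)
        = ∫⁻ _ in slab n 0 a r, ENNReal.ofReal m := (setLIntegral_const _ _).symm
      _ ≤ ∫⁻ x in slab n 0 a r, ENNReal.ofReal a *
            ∑ k ∈ Finset.range N, ‖gradient u (x + (k * a) • e₀ n)‖ₑ := by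
          refine setLIntegral_mono_ae' (measurableSet_slab _ _ _) ?_
          filter_upwards [hdiff] with x hd hx
          obtain ⟨h1, h2⟩ := hm x hx
          have h3 := sub_le_sum_norm_gradient hu ha.le N h1 fun k hk ↦ hd k (h1 k hk.le)
          refine (ENNReal.ofReal_le_ofReal (h2.trans h3)).trans ?_
          rw [ENNReal.ofReal_mul ha.le, ENNReal.ofReal_sum_of_nonneg fun _ _ ↦ norm_nonneg _]
          simp only [ofReal_norm, le_refl]
      _ = ENNReal.ofReal a * ∑ k ∈ Finset.range N,
            ∫⁻ x in slab n (k * a) ((k + 1) * a) r, ‖gradient u x‖ₑ := by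
          have hmk : ∀ k : ℕ, Measurable fun x ↦ ‖gradient u (x + (k * a) • e₀ n)‖ₑ := fun k ↦
            hmeas.comp (measurable_id.add_const _)
          rw [lintegral_const_mul _ (Finset.measurable_fun_sum _ fun k _ ↦ hmk k),
            lintegral_finsetSum _ fun k _ ↦ hmk k]
          congr 1
          refine Finset.sum_congr rfl fun k _ ↦ ?_
          rw [setLIntegral_slab_add (fun x ↦ ‖gradient u x‖ₑ)]
          congr 3 <;> ring
      _ ≤ _ := by gcongr; exact sum_setLIntegral_slab_le _ ha.le r N
  rw [volume_slab, sub_zero, mul_left_comm] at key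
  exact (ENNReal.mul_le_mul_iff_right (by simpa using ha) ENNReal.ofReal_ne_top).1 key

variable {Ω : Set (E n)} {ρ c : ℝ} {u : E n → ℝ}

/-- Lower bound for the `L¹` norm of the gradient near the flat disc. -/
theorem IsAdmissible.eventually_growth_le_lintegral (hn : 2 ≤ n) (hΩ : IsConvexDomain Ω)
    (hu : IsAdmissible Ω ρ c u) :
    ∃ R > 0, ∃ κ > 0, ∃ r > 0, ∀ᶠ t in 𝓝[>] (0 : ℝ), slab n 0 t r ⊆ Ω ∧
      ENNReal.ofReal (κ * growth n (R * t)) * ENNReal.ofReal (2 * r) ^ (n - 1) ≤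
        ∫⁻ x in slab n 0 t r, ‖gradient u x‖ₑ := by
  obtain ⟨R, hR, ε, hε, C, δ, hδ, h⟩ := hu.exists_growth hn hΩ
  have hn0 : (0 : ℝ) < n := by positivity
  refine ⟨R, hR, ε / 4, by positivity, δ / n, by positivity, ?_⟩
  filter_upwards [(tendsto_mul_nhdsGT_zero hR).eventually
      (eventually_mul_rpow_le_growth hn (Or.inr rfl) (2 / ε * ((|C| + 1) / R))),
    nhdsWithin_le_nhds (eventually_lt_nhds (half_pos hδ)), self_mem_nhdsWithin]
    with t h1 h2 (ht : 0 < t)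
  refine ⟨fun x hx ↦ (h x (slab_subset_cylinder hn hδ le_rfl (by linarith) hx)).1, ?_⟩
  rw [Real.rpow_one] at h1
  have h1' : (|C| + 1) * t ≤ ε / 2 * growth n (R * t) := by
    have := mul_le_mul_of_nonneg_left h1 (by positivity : 0 ≤ ε / 2)
    have e : ε / 2 * (2 / ε * ((|C| + 1) / R) * (R * t)) = (|C| + 1) * t := by field_simp
    rwa [e] at this
  have hCt : C * t ≤ |C| * t := by gcongr; exact le_abs_self C
  -- The drop from the disc to height `t` is at least `2m`. Shifting both end points by less than
  -- `δ₂` costs at most `m/2` each, which leaves `m`.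
  set m := ε / 4 * growth n (R * t) with hm
  have hm0 : 0 < m := by nlinarith [mul_nonneg (abs_nonneg C) ht.le]
  obtain ⟨δ₂, hδ₂, huc⟩ := Metric.uniformContinuousOn_iff.1
    (hΩ.isCompact_closure.uniformContinuousOn_of_continuous hu.continuousOn) (m / 2) (by positivity)
  -- The starting slab is thinner than `δ₂`, so its points are uniformly close to their feet on the
  -- disc.
  obtain ⟨N, hN⟩ := exists_nat_gt (t / δ₂)
  have hN0 : (0 : ℝ) < N := lt_of_le_of_lt (by positivity) hN
  have hN1 : (1 : ℝ) ≤ N := by exact_mod_cast Nat.one_le_iff_ne_zero.2 (by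
    rintro rfl; simp at hN0)
  have haδ : t / N < δ₂ := by
    rw [div_lt_iff₀ hδ₂] at hN
    rw [div_lt_iff₀ hN0]; linarith
  have hat : t / N ≤ t := div_le_self ht.le hN1
  have hNa : N * (t / N) = t := by field_simp
  have key := ofReal_mul_le_lintegral_gradient (r := δ / n) (m := m) hΩ.1
    (hu.convexOn.subset subset_closure hΩ.2.2) (a := t / N) (by positivity) N ?_
  · rwa [hNa] at key
  intro x hx
  have hxδ := norm_dropFirst_lt_of_mem_slab hn hδ hx
  have hx0 : 0 < x 0 := hx.1.1
  have hxa : x 0 < t / N := hx.1.2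
  have hcyl : ∀ s : ℝ, 0 ≤ s → s ≤ t → x + s • e₀ n ∈ cylinder n δ δ := fun s hs hst ↦ by
    refine ⟨?_, ?_, ?_⟩
    · simpa using by positivity
    · simp only [PiLp.add_apply, PiLp.smul_apply, e₀_zero, smul_eq_mul, mul_one]
      linarith
    · simpa [dropFirst_add, dropFirst_smul] using hxδ
  have hbase : dropFirst x + t • e₀ n ∈ cylinder n δ δ := by
    refine ⟨?_, ?_, ?_⟩
    · simpa [dropFirst_zero] using ht
    · simp only [PiLp.add_apply, PiLp.smul_apply, e₀_zero, smul_eq_mul, mul_one, dropFirst_zero]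
      linarith
    · simpa [dropFirst_add, dropFirst_smul] using hxδ
  have hx' : x ∈ cylinder n δ δ := by simpa using hcyl 0 le_rfl ht.le
  refine ⟨fun k hk ↦ (h _ (hcyl _ (by positivity) ?_)).1, ?_⟩
  · calc (k : ℝ) * (t / N) ≤ N * (t / N) := by gcongr
      _ = t := hNa
  rw [hNa]
  obtain ⟨g1, g2, g3⟩ := h _ hbase
  obtain ⟨g4, g5, -⟩ := h x hx'
  have hdist : dist x (dropFirst x) < δ₂ := by
    have hsub : x - dropFirst x = x 0 • e₀ n := by rw [dropFirst_eq]; abel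
    rw [dist_eq_norm, hsub, norm_smul, norm_e₀, mul_one, Real.norm_of_nonneg hx0.le]
    linarith
  have d1 := huc _ (subset_closure g4) _ g5 hdist
  have d2 := huc _ (subset_closure (h _ (hcyl t ht.le le_rfl)).1) _ (subset_closure g1)
    (by rwa [dist_add_right])
  rw [Real.dist_eq] at d1 d2
  have d1' := abs_lt.1 d1
  have d2' := abs_lt.1 d2
  simp only [dropFirst_add, dropFirst_dropFirst, dropFirst_smul, dropFirst_e₀, smul_zero,
    add_zero, PiLp.add_apply, PiLp.smul_apply, e₀_zero, smul_eq_mul, mul_one, dropFirst_zero,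
    zero_add] at g3
  linarith [d1'.1, d2'.2]

theorem IsAdmissible.eventually_growth_le_eLpNorm (hn : 2 ≤ n) (hΩ : IsConvexDomain Ω)
    (hu : IsAdmissible Ω ρ c u) :
    ∃ R > 0, ∃ κ > 0, ∃ r > 0, ∀ᶠ t in 𝓝[>] (0 : ℝ), slab n 0 t r ⊆ Ω ∧
      ∀ q : ℝ≥0∞, 1 ≤ q →
      ENNReal.ofReal (κ * growth n (R * t)) * ENNReal.ofReal (2 * r) ^ (n - 1) ≤
        eLpNorm (gradient u) q (volume.restrict (slab n 0 t r)) *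
          (ENNReal.ofReal t * ENNReal.ofReal (2 * r) ^ (n - 1)) ^ (1 - 1 / q.toReal) := by
  obtain ⟨R, hR, κ, hκ, r, hr, h⟩ := hu.eventually_growth_le_lintegral hn hΩ
  refine ⟨R, hR, κ, hκ, r, hr, h.mono fun t ht ↦ ⟨ht.1, fun q hq ↦ ht.2.trans ?_⟩⟩
  have := eLpNorm_le_eLpNorm_mul_rpow_measure_univ (μ := volume.restrict (slab n 0 t r)) hq
    (measurable_gradient u).aestronglyMeasurable
  rw [eLpNorm_one_eq_lintegral_enorm, Measure.restrict_apply_univ, volume_slab] at this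
  simpa using this

theorem IsAdmissible.eLpNorm_gradient_top (hn : 2 ≤ n) (hΩ : IsConvexDomain Ω)
    (hu : IsAdmissible Ω ρ c u) : eLpNorm (gradient u) ⊤ (volume.restrict Ω) = ⊤ := by
  by_contra hfin
  obtain ⟨R, hR, κ, hκ, r, hr, h⟩ := hu.eventually_growth_le_eLpNorm hn hΩ
  set K := (eLpNorm (gradient u) ⊤ (volume.restrict Ω)).toReal with hK
  obtain ⟨t, ⟨hsub, h1⟩, h2, ht⟩ := (h.and (((tendsto_mul_nhdsGT_zero hR).eventually
    (eventually_mul_rpow_le_growth hn (Or.inr rfl) ((K + 1) / (κ * R)))).and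
    self_mem_nhdsWithin)).exists
  have ht : 0 < t := ht
  have h3 := h1 ⊤ le_top
  have hle : eLpNorm (gradient u) ⊤ (volume.restrict (slab n 0 t r)) ≤ ENNReal.ofReal K := by
    rw [hK, ENNReal.ofReal_toReal hfin]
    exact eLpNorm_mono_measure _ (Measure.restrict_mono hsub le_rfl)
  set V := ENNReal.ofReal (2 * r) ^ (n - 1) with hV
  have hV0 : V ≠ 0 := pow_ne_zero _ (by simpa using hr)
  have hVt : V ≠ ⊤ := ENNReal.pow_ne_top ENNReal.ofReal_ne_top
  have h4 : ENNReal.ofReal (κ * growth n (R * t)) * V ≤ ENNReal.ofReal (K * t) * V := by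
    refine h3.trans ?_
    rw [ENNReal.toReal_top, div_zero, sub_zero, ENNReal.rpow_one,
      ENNReal.ofReal_mul ENNReal.toReal_nonneg, mul_assoc]
    gcongr
  rw [ENNReal.mul_le_mul_iff_left hV0 hVt,
    ENNReal.ofReal_le_ofReal_iff (by positivity)] at h4
  rw [Real.rpow_one] at h2
  have h5 := mul_le_mul_of_nonneg_left h2 hκ.le
  have e : κ * ((K + 1) / (κ * R) * (R * t)) = (K + 1) * t := by field_simp
  rw [e] at h5
  linarith

theorem IsAdmissible.eLpNorm_gradient_eq_top (hn : 3 ≤ n) (hΩ : IsConvexDomain Ω)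
    (hu : IsAdmissible Ω ρ c u) :
    eLpNorm (gradient u) (ENNReal.ofReal (n / (n - 2) : ℝ)) (volume.restrict Ω) = ⊤ := by
  by_contra hfin
  have hn' : (3 : ℝ) ≤ n := by exact_mod_cast hn
  obtain ⟨R, hR, κ, hκ, r, hr, h⟩ := hu.eventually_growth_le_eLpNorm (by omega) hΩ
  obtain ⟨q, hq⟩ : ∃ q : ℝ, q = n / (n - 2) := ⟨_, rfl⟩
  have hq1 : 1 ≤ q := by rw [hq, le_div_iff₀ (by linarith)]; linarith
  -- The critical exponent: Hölder's power of `t` equals that of the growth function.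
  have hexp : 1 - 1 / q = 2 / n := by
    have : (n : ℝ) - 2 ≠ 0 := by linarith
    rw [hq]; field_simp; ring
  rw [← hq] at hfin
  have hqr : (ENNReal.ofReal q).toReal = q := ENNReal.toReal_ofReal (by linarith)
  have hq0 : ENNReal.ofReal q ≠ 0 := by simpa using by linarith
  set V := ENNReal.ofReal (2 * r) ^ (n - 1) with hV
  have hV0 : V ≠ 0 := pow_ne_zero _ (by simpa using hr)
  have hVt : V ≠ ⊤ := ENNReal.pow_ne_top ENNReal.ofReal_ne_top
  have hlow : ∀ᶠ t in 𝓝[>] (0 : ℝ), ENNReal.ofReal (κ * R ^ (2 / n : ℝ)) * V ≤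
      eLpNorm (gradient u) (ENNReal.ofReal q) (volume.restrict (slab n 0 t r)) *
        V ^ (2 / n : ℝ) := by
    filter_upwards [h, self_mem_nhdsWithin] with t ht (ht0 : 0 < t)
    have h1 := ht.2 (ENNReal.ofReal q) (by simpa using hq1)
    have hn2 : n ≠ 2 := by omega
    have htn : 0 < t ^ (2 / n : ℝ) := by positivity
    rw [hqr, hexp, growth, if_neg hn2, Real.mul_rpow hR.le ht0.le, ← mul_assoc κ,
      ENNReal.ofReal_mul (by positivity), ENNReal.mul_rpow_of_nonneg _ _ (by positivity),
      ENNReal.ofReal_rpow_of_pos ht0, mul_right_comm, mul_left_comm, mul_comm] at h1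
    exact (ENNReal.mul_le_mul_iff_right (by simpa using htn) ENNReal.ofReal_ne_top).1 h1
  -- If the norm were finite, absolute continuity of the integral would send the norm over shrinking
  -- slabs to zero, against the lower bound independent of `t`.
  have hlim : Tendsto (fun t : ℝ ↦
      eLpNorm (gradient u) (ENNReal.ofReal q) (volume.restrict (slab n 0 t r)))
      (𝓝[>] 0) (𝓝 0) := by
    have hint : ∫⁻ x in Ω, ‖gradient u x‖ₑ ^ q ≠ ⊤ := by
      have := lintegral_rpow_enorm_lt_top_of_eLpNorm_lt_top hq0 ENNReal.ofReal_ne_top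
        (lt_top_iff_ne_top.2 hfin)
      rw [hqr] at this
      exact this.ne
    have hvol : Tendsto (fun t : ℝ ↦ volume.restrict Ω (slab n 0 t r)) (𝓝[>] 0) (𝓝 0) := by
      have h0 : Tendsto (fun t : ℝ ↦ ENNReal.ofReal t * V) (𝓝[>] 0) (𝓝 0) := by
        have h00 : Tendsto (fun t : ℝ ↦ ENNReal.ofReal t) (𝓝[>] 0) (𝓝 0) := by
          have := ENNReal.continuous_ofReal.tendsto 0
          rw [ENNReal.ofReal_zero] at this
          exact this.mono_left nhdsWithin_le_nhds
        simpa using ENNReal.Tendsto.mul_const h00 (Or.inr hVt)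
      refine tendsto_of_tendsto_of_tendsto_of_le_of_le tendsto_const_nhds h0
        (fun _ ↦ zero_le) fun t ↦ ?_
      refine (Measure.restrict_apply_le _ _).trans_eq ?_
      simp only [volume_slab, sub_zero, hV]
    have h1 := tendsto_setLIntegral_zero hint hvol
    have h2 := (ENNReal.continuous_rpow_const (y := 1 / q)).tendsto 0 |>.comp h1
    rw [ENNReal.zero_rpow_of_pos (by positivity)] at h2
    refine h2.congr' ?_
    filter_upwards [h] with t ht
    rw [eLpNorm_eq_lintegral_rpow_enorm_toReal hq0 ENNReal.ofReal_ne_top, hqr,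
      Function.comp_apply, Measure.restrict_restrict (measurableSet_slab _ _ _),
      inter_eq_self_of_subset_left ht.1]
  have hlim2 := ENNReal.Tendsto.mul_const (b := V ^ (2 / n : ℝ)) hlim
    (Or.inr (ENNReal.rpow_ne_top_of_nonneg (by positivity) hVt))
  rw [zero_mul] at hlim2
  have hle := ge_of_tendsto hlim2 hlow
  have hpos : ENNReal.ofReal (κ * R ^ (2 / n : ℝ)) * V ≠ 0 :=
    mul_ne_zero (by simpa using by positivity) hV0
  exact hpos (le_zero_iff.1 hle)

end Blowup

end MongeAmpere

/-! ### Assembly of the theorem. -/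

theorem mainTheorem3 (n : ℕ) [NeZero n] (hn : 2 ≤ n) :
    ∃ Cn : ℝ, 0 < Cn ∧ ∀ Ω : Set (MongeAmpere.E n), MongeAmpere.IsConvexDomain Ω →
      -- a normalizing map exists, and may even be chosen to be a similarity
      (∀ ρ : ℝ, MongeAmpere.HasFlatDisc Ω ρ →
        ∃ L : MongeAmpere.E n ≃ᵃ[ℝ] MongeAmpere.E n,
          MongeAmpere.IsNormalizing Ω ρ L ∧ MongeAmpere.IsSimilarity L) ∧
      -- the pointwise lower bound; `C` depends only on `L` and the boundary values `g`
      (∀ (L : MongeAmpere.E n ≃ᵃ[ℝ] MongeAmpere.E n) (g : MongeAmpere.E n → ℝ), ∃ C : ℝ,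
        ∀ (ρ c : ℝ) (u : MongeAmpere.E n → ℝ), MongeAmpere.IsAdmissible Ω ρ c u →
          Set.EqOn u g (frontier Ω) → MongeAmpere.IsNormalizing Ω ρ L →
          ∀ x : MongeAmpere.E n, L x ∈ MongeAmpere.cylinder n 1 1 →
            u (MongeAmpere.footPoint L x) - u x ≥
                -C * ‖x - MongeAmpere.footPoint L x‖ +
                  Cn * c ^ (1 / n : ℝ) / MongeAmpere.absDet L ^ (2 / n : ℝ) *
                    MongeAmpere.growth n
                      ‖MongeAmpere.linPart L (x - MongeAmpere.footPoint L x)‖ ∧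
            (MongeAmpere.IsSimilarity L →
              u (MongeAmpere.footPoint L x) - u x ≥
                -C * ‖x - MongeAmpere.footPoint L x‖ +
                  Cn * c ^ (1 / n : ℝ) / MongeAmpere.absDet L ^ (2 / n : ℝ) *
                    MongeAmpere.growth n
                      (MongeAmpere.specNorm L * ‖x - MongeAmpere.footPoint L x‖))) ∧
      -- the consequences
      (∀ (ρ c : ℝ) (u : MongeAmpere.E n → ℝ), MongeAmpere.IsAdmissible Ω ρ c u →
        (∀ K : ℝ≥0, ¬ LipschitzOnWith K u (closure Ω)) ∧
        (∀ α : ℝ≥0, (2 / n : ℝ) < α → ∀ K : ℝ≥0, ¬ HolderOnWith K α u (closure Ω)) ∧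
        (∃ G : MongeAmpere.E n → MongeAmpere.E n, MongeAmpere.IsWeakGradient Ω u G) ∧
        (∀ G : MongeAmpere.E n → MongeAmpere.E n, MongeAmpere.IsWeakGradient Ω u G →
          eLpNorm G ⊤ (volume.restrict Ω) = ⊤ ∧
          (3 ≤ n → eLpNorm G (ENNReal.ofReal (n / (n - 2) : ℝ)) (volume.restrict Ω) = ⊤))) := by
  obtain ⟨c₁, hc₁, f, f', f'', hP, hf⟩ := MongeAmpere.exists_profile n hn
  refine ⟨c₁ / 2, by positivity, fun Ω hΩ ↦ ⟨fun ρ hρ ↦ ?_, fun L g ↦ ?_, fun ρ c u hu ↦ ?_⟩⟩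
  · obtain ⟨R, hR, hL⟩ := hρ.exists_isNormalizing_dilation hΩ
    exact ⟨_, hL, MongeAmpere.isSimilarity_dilation R hR.ne'⟩
  -- The constant is chosen before `u`. If `g` is unbounded on the frontier, no admissible `u` has
  -- these boundary values, and any constant will do.
  · by_cases hM : ∃ M, ∀ x ∈ frontier Ω, |g x| ≤ M
    · obtain ⟨M, hM⟩ := hM
      refine ⟨2 * M * MongeAmpere.specNorm L, fun ρ c u hu hug hL x hx ↦ ?_⟩
      have h := hu.foot_sub_ge hn hP hf hΩ hL (fun x hx ↦ by rw [hug hx]; exact hM x hx) hx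
      exact ⟨h, fun hsim ↦ by rwa [hsim] at h⟩
    · refine ⟨0, fun ρ c u hu hug ↦ absurd ?_ hM⟩
      obtain ⟨M, hM⟩ := hu.exists_frontier_bound hΩ
      exact ⟨M, fun x hx ↦ by rw [← hug hx]; exact hM x hx⟩
  · have hconv := hu.convexOn.subset subset_closure hΩ.2.2
    have hw := MongeAmpere.isWeakGradient_gradient hΩ.1 hconv
    refine ⟨hu.not_lipschitzOnWith hn hΩ, fun α hα ↦ hu.not_holderOnWith hn hΩ (Or.inl hα),
      ⟨_, hw⟩, fun G hG ↦ ⟨?_, fun hn3 ↦ ?_⟩⟩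
    · rw [eLpNorm_congr_ae (hG.ae_eq hΩ.1 hw)]
      exact hu.eLpNorm_gradient_top hn hΩ
    · rw [eLpNorm_congr_ae (hG.ae_eq hΩ.1 hw)]
      exact hu.eLpNorm_gradient_eq_top hn3 hΩ
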